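/- Proposition 2.4 (symmetry of the finite element Hessian). Let $d\ge 1$, $p\ge 0$, and let $\Omega\subset\mathbb{R}^d$ be an open set that equals the interior of its closure. Let $\mathcal{T}$ be a conforming triangulation of $\Omega$: a finite family of open $d$-simplices such that $\overline K\cap\overline J$ is a (possibly empty) full sub-simplex of both $\overline K$ and $\overline J$ for all $K,J\in\mathcal{T}$, and $\bigcup_{K\in\mathcal{T}}\overline K=\overline\Omega$. Let $\mathbb{P}^p(\mathcal{T})$ be the space of functions that coincide on each $K\in\mathcal{T}$ with a polynomial of total degree at most $p$, and put $$\mathbb{W}=\mathbb{P}^p(\mathcal{T})\cap C^0(\Omega),\qquad \mathbb{V}=\mathbb{P}^p(\mathcal{T})\cap C^0(\Omega)\cap H^1_0(\Omega),$$ where $H^1_0(\Omega)$ is the closure of $C_c^\infty(\Omega)$ in $H^1(\Omega)$. Then for each $V\in\mathbb{V}$ there is exactly one $\mathbf{H}[V]\in\mathbb{W}^{d\times d}$ (as a function on $\Omega$), the finite element Hessian of $V$, such that $$\int_\Omega \mathbf{H}[V]\,\Phi=-\int_\Omega\nabla V\otimes\nabla\Phi+\int_{\partial\Omega}\nabla V\otimes\mathbf{n}\,\Phi\qquad\forall\,\Phi\in\mathbb{W},$$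 and it is symmetric in the sense that $$\int_\Omega \mathbf{H}[V]\,\Phi=\int_\Omega (\mathbf{H}[V])^\top\,\Phi\qquad\forall\,\Phi\in\mathbb{W}.$$ Here $(a\otimes b)_{ij}=a_ib_j$, the gradients are taken on each simplex, $\mathbf{n}$ is the outward unit normal, and the boundary integral is the sum, over the facets of simplices $K\in\mathcal{T}$ that lie on $\partial\Omega$, of the integrals for $(d-1)$-dimensional surface measure, with the values of $\nabla V$ and $\Phi$ taken as limits from inside $K$. -/

import Mathlib

open MeasureTheory Set Filter Topology
open scoped ContDiff ENNReal

noncomputable section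

namespace FEHessian

/-- The space `ℝ^d` with the Euclidean norm. -/
abbrev E (d : ℕ) : Type := EuclideanSpace ℝ (Fin d)

variable {d : ℕ}

/-! ### Triangulations -/

/-- The closed simplex spanned by a finite set of vertices. -/
def closedCell (s : Finset (E d)) : Set (E d) := convexHull ℝ (s : Set (E d))

/-- The open simplex `K` spanned by a set of `d + 1` affinely independent vertices. -/
def cell (s : Finset (E d)) : Set (E d) := interior (closedCell s)

/-- A conforming triangulation of `Ω`: a finite family of open `d`-simplices, each given by its set
of vertices, such that the intersection of the closures of any two of them is a full sub-simplex
(possibly empty) of both, and such that the closures cover exactly the closure of `Ω`. -/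
structure Triangulation (Ω : Set (E d)) where
  /-- the vertex sets of the simplices -/
  cells : Finset (Finset (E d))
  card_eq : ∀ s ∈ cells, s.card = d + 1
  affineIndependent : ∀ s ∈ cells, AffineIndependent ℝ ((↑) : s → E d)
  conforming : ∀ s ∈ cells, ∀ t ∈ cells,
    ∃ u : Finset (E d), u ⊆ s ∧ u ⊆ t ∧ closedCell s ∩ closedCell t = closedCell u
  cover : ⋃ s ∈ cells, closedCell s = closure Ω

/-! ### Sobolev space of functions with zero boundary values -/

/-- `φ ∈ C_c^∞(Ω)`. -/
def IsTestFunction (Ω : Set (E d)) (φ : E d → ℝ) : Prop :=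
  ContDiff ℝ ∞ φ ∧ HasCompactSupport φ ∧ tsupport φ ⊆ Ω

/-- `g` is the weak gradient of `u` on `Ω`. -/
def HasWeakGradient (Ω : Set (E d)) (u : E d → ℝ) (g : E d → E d) : Prop :=
  ∀ φ : E d → ℝ, IsTestFunction Ω φ → ∀ i : Fin d,
    ∫ x in Ω, u x * gradient φ x i = -∫ x in Ω, g x i * φ x

/-- `u ∈ H_0^1(Ω)`, the closure of `C_c^∞(Ω)` in the norm of `H^1(Ω)`. -/
def MemH10 (Ω : Set (E d)) (u : E d → ℝ) : Prop :=
  ∃ g : E d → E d,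
    MemLp u 2 (volume.restrict Ω) ∧ MemLp g 2 (volume.restrict Ω) ∧ HasWeakGradient Ω u g ∧
    ∀ ε : ℝ≥0∞, 0 < ε → ∃ φ : E d → ℝ, IsTestFunction Ω φ ∧
      eLpNorm (fun x => u x - φ x) 2 (volume.restrict Ω) < ε ∧
      eLpNorm (fun x => g x - gradient φ x) 2 (volume.restrict Ω) < ε

/-! ### Finite element spaces

Functions on `Ω` are represented by functions on `ℝ^d`; none of the notions below depends on the
values outside `Ω`. -/

/-- `f ∈ ℙ^p(𝒯)`: on every open simplex of the triangulation `f` is a polynomial of total degree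
at most `p`. -/
def IsPiecewisePolynomial {Ω : Set (E d)} (T : Triangulation Ω) (p : ℕ) (f : E d → ℝ) : Prop :=
  ∀ s ∈ T.cells, ∃ P : MvPolynomial (Fin d) ℝ, P.totalDegree ≤ p ∧
    ∀ x ∈ cell s, f x = MvPolynomial.eval (fun i => x i) P

/-- The finite element space `𝕎 = ℙ^p(𝒯) ∩ C⁰(Ω)`. -/
def spaceW {Ω : Set (E d)} (T : Triangulation Ω) (p : ℕ) : Set (E d → ℝ) :=
  {f | IsPiecewisePolynomial T p f ∧ ContinuousOn f Ω}

/-- The finite element space `𝕍 = ℙ^p(𝒯) ∩ C⁰(Ω) ∩ H_0^1(Ω)`. -/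
def spaceV {Ω : Set (E d)} (T : Triangulation Ω) (p : ℕ) : Set (E d → ℝ) :=
  {f | f ∈ spaceW T p ∧ MemH10 Ω f}

/-! ### Integrals -/

/-- The matrix `∫_Ω M φ`, entry by entry. -/
def matrixIntegral (Ω : Set (E d)) (M : E d → Matrix (Fin d) (Fin d) ℝ) (φ : E d → ℝ) :
    Matrix (Fin d) (Fin d) ℝ :=
  Matrix.of fun i j => ∫ x in Ω, M x i j * φ x

/-- The matrix `∫_Ω ∇v ⊗ ∇φ`. For piecewise polynomials the gradient is the classical one on every
open simplex, hence almost everywhere on `Ω`. -/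
def stiffnessIntegral (Ω : Set (E d)) (v φ : E d → ℝ) : Matrix (Fin d) (Fin d) ℝ :=
  Matrix.of fun i j => ∫ x in Ω, gradient v x i * gradient φ x j

open Classical in
/-- The facet of the simplex with vertex set `s` that lies opposite to the vertex `v`. -/
def facet (s : Finset (E d)) (v : E d) : Finset (E d) := s.erase v

/-- The component, orthogonal to the facet opposite to `v`, of a vector that leads from `v` to that
facet. -/
def altitudeVec (s : Finset (E d)) (v : E d) : E d :=
  (vectorSpan ℝ (facet s v : Set (E d)))ᗮ.starProjection ((facet s v).centroid ℝ id - v)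

/-- The unit normal, on the facet opposite to `v`, that points out of the simplex. -/
def outwardNormal (s : Finset (E d)) (v : E d) : E d :=
  ‖altitudeVec s v‖⁻¹ • altitudeVec s v

open Classical in
/-- The matrix `∫_{∂Ω} ∇v ⊗ n φ`, where `n` is the outward unit normal of `Ω`: the sum, over the
facets of the triangulation that lie on `∂Ω`, of the integrals for the `(d-1)`-dimensional surface
measure. On a facet of the simplex `K` the values of `∇v` and `φ` are the limits from inside `K`,
and `n` is the unit normal pointing out of `K`. -/
def boundaryIntegral {Ω : Set (E d)} (T : Triangulation Ω) (v φ : E d → ℝ) :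
    Matrix (Fin d) (Fin d) ℝ :=
  Matrix.of fun i j =>
    ∑ s ∈ T.cells, ∑ w ∈ s with closedCell (facet s w) ⊆ frontier Ω,
      ∫ x in closedCell (facet s w),
        extendFrom (cell s) (gradient v) x i * outwardNormal s w j * extendFrom (cell s) φ x
          ∂(Measure.euclideanHausdorffMeasure (d - 1))

/-! ### The finite element Hessian -/

/-- `H` is the finite element Hessian of `V`: it belongs to `𝕎^{d×d}` and satisfies
`∫_Ω H Φ = -∫_Ω ∇V ⊗ ∇Φ + ∫_{∂Ω} ∇V ⊗ n Φ` for all `Φ ∈ 𝕎`. -/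
def IsFEHessian {Ω : Set (E d)} (T : Triangulation Ω) (p : ℕ) (V : E d → ℝ)
    (H : E d → Matrix (Fin d) (Fin d) ℝ) : Prop :=
  (∀ i j, (fun x => H x i j) ∈ spaceW T p) ∧
  ∀ Φ ∈ spaceW T p,
    matrixIntegral Ω H Φ = -stiffnessIntegral Ω V Φ + boundaryIntegral T V Φ

end FEHessian

end

open scoped NNReal

noncomputable section

namespace FEHessian

section

variable {d : ℕ}

/-! ### Lipschitz functions on closed covers -/

/-! Existence and uniqueness are Riesz representation: functions of `spaceW`, normalised to vanish
outside `Ω`, form a finite-dimensional space on which the `L²` form is definite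
(`exists_forall_integral_mul_eq`, `IsFEHessian.eqOn`).

Symmetry holds because both terms of the right-hand side are symmetric matrices. For the volume
term, density of test functions in `H_0^1` reduces the claim to a test function `φ`, where `∫ ∂ᵢφ
∂ⱼΦ = -∫ Φ ∂ⱼ∂ᵢφ` is symmetric by Schwarz (`integral_gradient_mul_gradient_comm`). For the boundary
term, `V` has zero trace on boundary facets, so `∇V` is parallel to the normal and `∇V ⊗ n` is
symmetric pointwise (`gradient_mul_outwardNormal_comm`).

Integration by parts uses no divergence theorem on simplices: a function that is Lipschitz on each
member of a finite closed cover is Lipschitz, and the line derivative of a compactly supported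
Lipschitz function has integral zero. The zero trace (`eq_zero_of_halfBall`) comes from the same
principle, applied on a small cap attached to the facet. -/

theorem abs_sub_le_of_finite_closed_cover {ι : Type*} [DecidableEq ι] (C : ι → Set ℝ)
    (hC : ∀ i, IsClosed (C i)) (f : ℝ → ℝ) (L : ℝ)
    (hL : ∀ i, ∀ x ∈ C i, ∀ y ∈ C i, |f x - f y| ≤ L * |x - y|) (b : ℝ) (S : Finset ι) :
    ∀ a, a ≤ b → Icc a b ⊆ ⋃ i ∈ S, C i → |f a - f b| ≤ L * (b - a) := by
  induction S using Finset.strongInduction with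
  | H S ih =>
    intro a hab hS
    obtain ⟨i, hi, hai⟩ : ∃ i ∈ S, a ∈ C i := by
      simpa using hS (left_mem_Icc.2 hab)
    have hcomp : IsCompact (C i ∩ Icc a b) := isCompact_Icc.inter_left (hC i)
    have hne : (C i ∩ Icc a b).Nonempty := ⟨a, hai, left_mem_Icc.2 hab⟩
    obtain ⟨hc, hca, hcb⟩ := hcomp.sSup_mem hne
    -- Beyond the last point `c` of `C i`, the other members cover `(c, b]`, and being closed they
    -- cover `c` too; the induction continues from `c` without `C i`.
    set c := sSup (C i ∩ Icc a b) with hcdef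
    have h1 : |f a - f c| ≤ L * (c - a) := by
      have := hL i a hai c hc
      rwa [abs_sub_comm a c, abs_of_nonneg (sub_nonneg.2 hca)] at this
    rcases hcb.eq_or_lt with h | h
    · rw [← h]; exact h1
    · have hsub : Icc c b ⊆ ⋃ j ∈ S.erase i, C j := by
        rw [← closure_Ioc h.ne]
        refine closure_minimal ?_ ?_
        · intro x hx
          obtain ⟨j, hj, hxj⟩ : ∃ j ∈ S, x ∈ C j := by
            simpa using hS ⟨hca.trans hx.1.le, hx.2⟩
          have hji : j ≠ i := by
            rintro rfl
            exact absurd (le_csSup hcomp.bddAbove ⟨hxj, hca.trans hx.1.le, hx.2⟩) (not_le.2 hx.1)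
          simp only [mem_iUnion]
          exact ⟨j, Finset.mem_erase.2 ⟨hji, hj⟩, hxj⟩
        · exact isClosed_biUnion_finset fun j _ => hC j
      have h2 := ih (S.erase i) (Finset.erase_ssubset hi) c h.le hsub
      calc |f a - f b| ≤ |f a - f c| + |f c - f b| := abs_sub_le _ _ _
        _ ≤ L * (c - a) + L * (b - c) := add_le_add h1 h2
        _ = L * (b - a) := by ring

/-- A function that is Lipschitz on every member of a finite closed cover is Lipschitz. -/
theorem lipschitzWith_of_finite_closed_cover {F ι : Type*} [NormedAddCommGroup F] [NormedSpace ℝ F]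
    [Fintype ι] (C : ι → Set F) (hC : ∀ i, IsClosed (C i)) (hU : ⋃ i, C i = univ)
    (f : F → ℝ) (hf : ∀ i, ∃ K : ℝ≥0, LipschitzOnWith K f (C i)) :
    ∃ K : ℝ≥0, LipschitzWith K f := by
  classical
  choose K hK using hf
  -- The sum serves only as a common upper bound for the `K i`. The cover is pulled back to the
  -- segment from `x` to `y`.
  refine ⟨∑ i, K i, LipschitzWith.of_dist_le_mul fun x y => ?_⟩
  have hline : Continuous fun t : ℝ => x + t • (y - x) := by fun_prop
  have := abs_sub_le_of_finite_closed_cover (fun i => (fun t : ℝ => x + t • (y - x)) ⁻¹' C i)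
    (fun i => (hC i).preimage hline) (fun t => f (x + t • (y - x)))
    ((∑ i, K i : ℝ≥0) * dist x y) ?_ 1 Finset.univ 0 zero_le_one ?_
  · simpa [Real.dist_eq] using this
  · intro i s hs t ht
    have h := (hK i).dist_le_mul _ hs _ ht
    have hd : dist (x + s • (y - x)) (x + t • (y - x)) = |s - t| * dist x y := by
      rw [dist_add_left, dist_eq_norm, ← sub_smul, norm_smul, Real.norm_eq_abs, ← dist_eq_norm,
        dist_comm y x]
    rw [Real.dist_eq, hd] at h
    refine h.trans ?_
    have hle : ((K i : ℝ≥0) : ℝ) ≤ (∑ i, K i : ℝ≥0) :=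
      NNReal.coe_le_coe.2 (Finset.single_le_sum (fun _ _ => zero_le) (Finset.mem_univ i))
    calc (K i : ℝ) * (|s - t| * dist x y) ≤ (∑ i, K i : ℝ≥0) * (|s - t| * dist x y) := by gcongr
      _ = _ := by ring
  · intro t _
    have : x + t • (y - x) ∈ ⋃ i, C i := hU ▸ mem_univ _
    simpa using this

theorem integral_lineDeriv_eq_zero {K : ℝ≥0} {f : E d → ℝ} (hf : LipschitzWith K f)
    (hc : HasCompactSupport f) (v : E d) : ∫ x, lineDeriv ℝ f x v = 0 := by
  -- Integration by parts against the constant `1`; the formula negates the direction, hence `-v`.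
  have h := LipschitzWith.integral_lineDeriv_mul_eq (μ := (volume : Measure (E d)))
    (LipschitzWith.const (1 : ℝ)) hf hc (-v)
  simpa [lineDeriv] using h.symm

theorem gradient_apply (f : E d → ℝ) (x : E d) (i : Fin d) :
    gradient f x i = fderiv ℝ f x (EuclideanSpace.single i 1) := by
  have h : inner ℝ (gradient f x) (EuclideanSpace.single i (1 : ℝ)) =
      fderiv ℝ f x (EuclideanSpace.single i 1) := by
    rw [gradient, InnerProductSpace.toDual_symm_apply]
  rw [← h, EuclideanSpace.inner_single_right]
  simp

theorem inner_gradient (f : E d → ℝ) (x v : E d) :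
    inner ℝ (gradient f x) v = fderiv ℝ f x v := by
  rw [gradient, InnerProductSpace.toDual_symm_apply]

theorem continuous_gradient {f : E d → ℝ} (hf : ContDiff ℝ ∞ f) : Continuous (gradient f) :=
  (InnerProductSpace.toDual ℝ (E d)).symm.continuous.comp (hf.continuous_fderiv (by simp))

/-! ### Geometry of the triangulation -/

theorem convex_closedCell (s : Finset (E d)) : Convex ℝ (closedCell s) := convex_convexHull ℝ _

theorem isCompact_closedCell (s : Finset (E d)) : IsCompact (closedCell s) :=
  s.finite_toSet.isCompact_convexHull ℝ

theorem isOpen_cell (s : Finset (E d)) : IsOpen (cell s) := isOpen_interior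

theorem cell_subset_closedCell (s : Finset (E d)) : cell s ⊆ closedCell s := interior_subset

namespace Triangulation

variable {Ω : Set (E d)} (T : Triangulation Ω)

include T in
theorem isCompact_closure : IsCompact (closure Ω) := by
  rw [← T.cover]
  exact T.cells.isCompact_biUnion fun s _ => isCompact_closedCell s

theorem closedCell_subset {s : Finset (E d)} (hs : s ∈ T.cells) : closedCell s ⊆ closure Ω := by
  rw [← T.cover]
  exact subset_biUnion_of_mem (u := fun s => closedCell s) hs

theorem cell_subset (hΩ : interior (closure Ω) = Ω) {s : Finset (E d)} (hs : s ∈ T.cells) :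
    cell s ⊆ Ω := by
  conv_rhs => rw [← hΩ]
  exact interior_mono (T.closedCell_subset hs)

theorem cell_nonempty {s : Finset (E d)} (hs : s ∈ T.cells) : (cell s).Nonempty := by
  rw [cell, closedCell, interior_convexHull_nonempty_iff_affineSpan_eq_top]
  have h := (T.affineIndependent s hs).affineSpan_eq_top_iff_card_eq_finrank_add_one.2
    (by simp [T.card_eq s hs])
  simpa using h

theorem closedCell_subset_closure_cell {s : Finset (E d)} (hs : s ∈ T.cells) :
    closedCell s ⊆ closure (cell s) := by
  rw [cell, (convex_closedCell s).closure_interior_eq_closure_of_nonempty_interior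
    (T.cell_nonempty hs)]
  exact subset_closure

/-- The frontier of a convex set is a null set, so the open cells exhaust `Ω` up to measure zero. -/
theorem ae_mem_cell (hΩ : interior (closure Ω) = Ω) :
    ∀ᵐ x ∂(volume.restrict Ω), ∃ s ∈ T.cells, x ∈ cell s := by
  have h : ∀ᵐ x : E d, ∀ s ∈ T.cells, x ∉ frontier (closedCell s) := by
    rw [Filter.eventually_all_finset]
    exact fun s _ => measure_eq_zero_iff_ae_notMem.1 ((convex_closedCell s).addHaar_frontier volume)
  refine (ae_restrict_iff' (hΩ ▸ isOpen_interior : IsOpen Ω).measurableSet).2 ?_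
  filter_upwards [h] with x hx hxΩ
  have hxc : x ∈ ⋃ s ∈ T.cells, closedCell s := T.cover ▸ subset_closure hxΩ
  simp only [mem_iUnion] at hxc
  obtain ⟨s, hs, hxs⟩ := hxc
  refine ⟨s, hs, by_contra fun hn => hx s hs ?_⟩
  rw [(isCompact_closedCell s).isClosed.frontier_eq]
  exact ⟨hxs, hn⟩

/-- A function that agrees with a continuous function on each cell of the triangulation. -/
def PiecewiseContinuous {F : Type*} [TopologicalSpace F] (h : E d → F) : Prop :=
  ∀ s ∈ T.cells, ∃ G : E d → F, Continuous G ∧ EqOn h G (cell s)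

variable {T}

theorem PiecewiseContinuous.comp₂ {F G H : Type*} [TopologicalSpace F] [TopologicalSpace G]
    [TopologicalSpace H] {f : E d → F} {g : E d → G} (hf : T.PiecewiseContinuous f)
    (hg : T.PiecewiseContinuous g) {op : F → G → H} (hop : Continuous fun z : F × G => op z.1 z.2) :
    T.PiecewiseContinuous fun x => op (f x) (g x) := fun s hs => by
  obtain ⟨f', hf', hff⟩ := hf s hs
  obtain ⟨g', hg', hgg⟩ := hg s hs
  exact ⟨fun x => op (f' x) (g' x), hop.comp (hf'.prodMk hg'), fun x hx => by
    simp only [hff hx, hgg hx]⟩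

theorem PiecewiseContinuous.mul {f g : E d → ℝ} (hf : T.PiecewiseContinuous f)
    (hg : T.PiecewiseContinuous g) : T.PiecewiseContinuous fun x => f x * g x :=
  hf.comp₂ hg continuous_mul

theorem _root_.Continuous.piecewiseContinuous {F : Type*} [TopologicalSpace F] {f : E d → F}
    (hf : Continuous f) : T.PiecewiseContinuous f := fun _ _ => ⟨f, hf, fun _ _ => rfl⟩

/-- Each continuous extension is bounded on its compact cell and `Ω` has finite measure.
Integrability over `Ω` of finite element functions and their gradients rests on this. -/
theorem PiecewiseContinuous.memLp (hΩ : interior (closure Ω) = Ω) {F : Type*}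
    [NormedAddCommGroup F] {f : E d → F} (hf : T.PiecewiseContinuous f) (q : ℝ≥0∞) :
    MemLp f q (volume.restrict Ω) := by
  have hfin : IsFiniteMeasure (volume.restrict Ω) := by
    refine ⟨?_⟩
    rw [Measure.restrict_apply_univ]
    exact (measure_mono subset_closure).trans_lt T.isCompact_closure.measure_lt_top
  choose! G hG hfG using hf
  have hle : volume.restrict Ω ≤ volume.restrict (⋃ s ∈ T.cells, cell s) := by
    have : Ω =ᵐ[volume] (Ω ∩ ⋃ s ∈ T.cells, cell s : Set (E d)) := by
      have := (ae_restrict_iff' (hΩ ▸ isOpen_interior : IsOpen Ω).measurableSet).1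
        (T.ae_mem_cell hΩ)
      filter_upwards [this] with x hx
      refine propext ⟨fun h => ⟨h, ?_⟩, fun h => h.1⟩
      simpa using hx h
    rw [Measure.restrict_congr_set this]
    exact Measure.restrict_mono inter_subset_right le_rfl
  have hmeas : AEStronglyMeasurable f (volume.restrict Ω) := by
    refine AEStronglyMeasurable.mono_measure ?_ hle
    have hU : ⋃ s ∈ T.cells, cell s = ⋃ s : T.cells, cell (s : Finset (E d)) := by
      ext x
      simp
    rw [hU, aestronglyMeasurable_iUnion_iff]
    rintro ⟨s, hs⟩
    refine ((hG s hs).aestronglyMeasurable (μ := volume.restrict (cell s))).congr ?_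
    exact (ae_restrict_iff' (isOpen_cell s).measurableSet).2
      (Eventually.of_forall fun x hx => (hfG s hs hx).symm)
  have hb : ∀ s ∈ T.cells, ∃ C : ℝ, ∀ x ∈ closedCell s, ‖G s x‖ ≤ C := fun s hs =>
    (isCompact_closedCell s).exists_bound_of_continuousOn (hG s hs).continuousOn
  choose! C hC using hb
  refine MemLp.of_bound hmeas (∑ s ∈ T.cells, |C s|) ?_
  filter_upwards [T.ae_mem_cell hΩ] with x ⟨s, hs, hx⟩
  rw [hfG s hs hx]
  exact ((hC s hs x (cell_subset_closedCell s hx)).trans (le_abs_self _)).trans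
    (Finset.single_le_sum (f := fun s => |C s|) (fun _ _ => abs_nonneg _) hs)

theorem PiecewiseContinuous.integrable (hΩ : interior (closure Ω) = Ω) {F : Type*}
    [NormedAddCommGroup F] {f : E d → F} (hf : T.PiecewiseContinuous f) :
    Integrable f (volume.restrict Ω) :=
  memLp_one_iff_integrable.1 (hf.memLp hΩ 1)

end Triangulation

/-! ### Finite element functions -/

theorem contDiff_eval (P : MvPolynomial (Fin d) ℝ) :
    ContDiff ℝ ∞ fun x : E d => MvPolynomial.eval (fun i => x i) P := by
  induction P using MvPolynomial.induction_on with
  | C a => simpa using contDiff_const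
  | add P Q hP hQ => simpa using hP.add hQ
  | mul_X P i hP =>
    simp only [map_mul, MvPolynomial.eval_X]
    exact hP.mul (by fun_prop)

variable {Ω : Set (E d)} {T : Triangulation Ω} {p : ℕ} {f : E d → ℝ}

/-- Agreement passes from the open cell to the points of its closure in `Ω` by continuity. It stops
at `∂Ω`, where cells touching only at a boundary point may have different limits. -/
theorem exists_contDiff_of_mem_spaceW (hΩ : interior (closure Ω) = Ω) (hf : f ∈ spaceW T p)
    {s : Finset (E d)} (hs : s ∈ T.cells) :
    ∃ G : E d → ℝ, ContDiff ℝ ∞ G ∧ EqOn f G (cell s) ∧ EqOn f G (closedCell s ∩ Ω) := by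
  obtain ⟨P, -, hP⟩ := hf.1 s hs
  refine ⟨_, contDiff_eval P, hP, fun x hx => ?_⟩
  have : (𝓝[cell s] x).NeBot :=
    mem_closure_iff_nhdsWithin_neBot.1 (T.closedCell_subset_closure_cell hs hx.1)
  refine tendsto_nhds_unique ((hf.2 x hx.2).mono_left (nhdsWithin_mono x (T.cell_subset hΩ hs))) ?_
  refine (((contDiff_eval P).continuous.tendsto x).mono_left nhdsWithin_le_nhds).congr' ?_
  filter_upwards [self_mem_nhdsWithin] with y hy using (hP y hy).symm

theorem eventuallyEq_of_eqOn_cell {F : Type*} {g G : E d → F} {s : Finset (E d)}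
    (h : EqOn g G (cell s)) {x : E d} (hx : x ∈ cell s) : g =ᶠ[𝓝 x] G :=
  h.eventuallyEq_of_mem ((isOpen_cell s).mem_nhds hx)

theorem eqOn_gradient {g G : E d → ℝ} {s : Finset (E d)} (h : EqOn g G (cell s)) :
    EqOn (gradient g) (gradient G) (cell s) := fun x hx => by
  rw [gradient, gradient, (eventuallyEq_of_eqOn_cell h hx).fderiv_eq]

theorem piecewiseContinuous_of_mem_spaceW (hΩ : interior (closure Ω) = Ω) (hf : f ∈ spaceW T p) :
    T.PiecewiseContinuous f := fun _ hs => by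
  obtain ⟨G, hG, h, -⟩ := exists_contDiff_of_mem_spaceW hΩ hf hs
  exact ⟨G, hG.continuous, h⟩

theorem piecewiseContinuous_gradient (hΩ : interior (closure Ω) = Ω) (hf : f ∈ spaceW T p) :
    T.PiecewiseContinuous (gradient f) := fun _ hs => by
  obtain ⟨G, hG, h, -⟩ := exists_contDiff_of_mem_spaceW hΩ hf hs
  exact ⟨gradient G, continuous_gradient hG, eqOn_gradient h⟩

theorem piecewiseContinuous_gradient_apply (hΩ : interior (closure Ω) = Ω) (hf : f ∈ spaceW T p)
    (i : Fin d) : T.PiecewiseContinuous fun x => gradient f x i := fun s hs => by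
  obtain ⟨G, hG, h⟩ := piecewiseContinuous_gradient hΩ hf s hs
  exact ⟨fun x => G x i, by fun_prop, fun x hx => by simp only [h hx]⟩

/-- The product of a finite element function with a test function is Lipschitz. -/
theorem lipschitz_mul_testFunction (hΩ : interior (closure Ω) = Ω) (hf : f ∈ spaceW T p)
    {ψ : E d → ℝ} (hψ : IsTestFunction Ω ψ) :
    ∃ K : ℝ≥0, LipschitzWith K fun x => f x * ψ x := by
  have hψ0 : ∀ x, x ∉ Ω → ψ x = 0 := fun x hx =>
    image_eq_zero_of_notMem_tsupport fun h => hx (hψ.2.2 h)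
  -- The closed cells together with the complement of `Ω` cover the whole space. At points of a
  -- closed cell outside `Ω`, where `f` is uncontrolled, the factor `ψ` vanishes.
  let C : Option T.cells → Set (E d) := fun o => o.elim Ωᶜ fun s => closedCell s
  refine lipschitzWith_of_finite_closed_cover C ?_ ?_ _ ?_
  · rintro (_ | s)
    · exact (hΩ ▸ isOpen_interior : IsOpen Ω).isClosed_compl
    · exact (isCompact_closedCell _).isClosed
  · refine eq_univ_of_forall fun x => ?_
    by_cases hx : x ∈ Ω
    · have hxc : x ∈ ⋃ s ∈ T.cells, closedCell s := T.cover ▸ subset_closure hx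
      simp only [mem_iUnion] at hxc
      obtain ⟨s, hs, hxs⟩ := hxc
      exact mem_iUnion.2 ⟨some ⟨s, hs⟩, hxs⟩
    · exact mem_iUnion.2 ⟨none, hx⟩
  · rintro (_ | ⟨s, hs⟩)
    · refine ⟨0, fun x hx y hy => ?_⟩
      simp [hψ0 x hx, hψ0 y hy]
    · obtain ⟨G, hG, -, h⟩ := exists_contDiff_of_mem_spaceW hΩ hf hs
      obtain ⟨K, hK⟩ := (hG.mul hψ.1).contDiffOn.exists_lipschitzOnWith (by simp)
        (convex_closedCell s) (isCompact_closedCell s)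
      have heq : EqOn (fun x => f x * ψ x) (fun x => G x * ψ x) (closedCell s) := fun x hx => by
        by_cases hxΩ : x ∈ Ω
        · simp [h ⟨hx, hxΩ⟩]
        · simp [hψ0 x hxΩ]
      refine ⟨K, fun x hx y hy => ?_⟩
      rw [heq hx, heq hy]
      exact hK hx hy

theorem IsTestFunction.fderiv_apply {ψ : E d → ℝ} (hψ : IsTestFunction Ω ψ) (v : E d) :
    IsTestFunction Ω fun x => fderiv ℝ ψ x v :=
  ⟨(hψ.1.fderiv_right (by simp)).clm_apply contDiff_const, hψ.2.1.fderiv_apply ℝ v,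
    (tsupport_fderiv_apply_subset ℝ v).trans hψ.2.2⟩

/-- Integration by parts of a finite element function against a test function. -/
theorem integral_fderiv_mul_testFunction (hΩ : interior (closure Ω) = Ω) (hf : f ∈ spaceW T p)
    {ψ : E d → ℝ} (hψ : IsTestFunction Ω ψ) (v : E d) :
    ∫ x in Ω, fderiv ℝ f x v * ψ x = -∫ x in Ω, f x * fderiv ℝ ψ x v := by
  obtain ⟨K, hK⟩ := lipschitz_mul_testFunction hΩ hf hψ
  have h0 := integral_lineDeriv_eq_zero hK (hψ.2.1.mul_left (f := f)) v
  have hout : ∀ x, x ∉ Ω → lineDeriv ℝ (fun x => f x * ψ x) x v = 0 := fun x hx => by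
    have hev : (fun x => f x * ψ x) =ᶠ[𝓝 x] fun _ => 0 := by
      filter_upwards [notMem_tsupport_iff_eventuallyEq.1 fun h => hx (hψ.2.2 h)] with y hy
      simp [hy]
    rw [hev.lineDeriv_eq]
    simp [lineDeriv]
  rw [← setIntegral_eq_integral_of_forall_compl_eq_zero hout] at h0
  have hgrad : T.PiecewiseContinuous fun x => fderiv ℝ f x v := fun s hs => by
    obtain ⟨G, hG, h⟩ := piecewiseContinuous_gradient hΩ hf s hs
    exact ⟨fun x => inner ℝ (G x) v, by fun_prop, fun x hx => by
      simp only [← h hx, inner_gradient]⟩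
  have hi1 := (hgrad.mul hψ.1.continuous.piecewiseContinuous).integrable hΩ
  have hi2 := ((piecewiseContinuous_of_mem_spaceW hΩ hf).mul
    (hψ.fderiv_apply v).1.continuous.piecewiseContinuous).integrable hΩ
  rw [eq_neg_iff_add_eq_zero, ← integral_add hi1 hi2, ← h0]
  refine integral_congr_ae ?_
  filter_upwards [T.ae_mem_cell hΩ] with x ⟨s, hs, hx⟩
  obtain ⟨G, hG, h, -⟩ := exists_contDiff_of_mem_spaceW hΩ hf hs
  have hev := eventuallyEq_of_eqOn_cell h hx
  have hfx : DifferentiableAt ℝ f x :=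
    (hG.differentiable (by simp) x).congr_of_eventuallyEq hev
  have hψx : DifferentiableAt ℝ ψ x := hψ.1.differentiable (by simp) x
  rw [(hfx.fun_mul hψx).lineDeriv_eq_fderiv, fderiv_fun_mul hfx hψx]
  simp
  ring

end

section

variable {d : ℕ} {Ω : Set (E d)} {T : Triangulation Ω} {p : ℕ} {f : E d → ℝ}

/-! ### Functions in `H_0^1` -/

theorem abs_integral_inner_le {X F : Type*} [MeasurableSpace X] {μ : Measure X}
    [NormedAddCommGroup F] [InnerProductSpace ℝ F] {f g : X → F} (hf : MemLp f 2 μ)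
    (hg : MemLp g 2 μ) :
    |∫ x, inner ℝ (f x) (g x) ∂μ| ≤ (eLpNorm f 2 μ).toReal * (eLpNorm g 2 μ).toReal := by
  have h := abs_real_inner_le_norm (hf.toLp f) (hg.toLp g)
  rw [Lp.norm_toLp, Lp.norm_toLp, L2.inner_def] at h
  convert h using 2
  refine integral_congr_ae ?_
  filter_upwards [hf.coeFn_toLp, hg.coeFn_toLp] with x h1 h2
  rw [h1, h2]

theorem integrable_inner_of_memLp {X F : Type*} [MeasurableSpace X] {μ : Measure X}
    [NormedAddCommGroup F] [InnerProductSpace ℝ F] {f g : X → F} (hf : MemLp f 2 μ)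
    (hg : MemLp g 2 μ) : Integrable (fun x => inner ℝ (f x) (g x)) μ := by
  refine (L2.integrable_inner (𝕜 := ℝ) (hf.toLp f) (hg.toLp g)).congr ?_
  filter_upwards [hf.coeFn_toLp, hg.coeFn_toLp] with x h1 h2
  rw [h1, h2]

/-- The weak gradient of a finite element function is its piecewise gradient. -/
theorem ae_eq_gradient_of_hasWeakGradient (hΩ : interior (closure Ω) = Ω) (hf : f ∈ spaceW T p)
    {g : E d → E d} (hg : MemLp g 2 (volume.restrict Ω)) (hw : HasWeakGradient Ω f g) :
    g =ᵐ[volume.restrict Ω] gradient f := by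
  have hopen : IsOpen Ω := hΩ ▸ isOpen_interior
  have hfin : IsFiniteMeasure (volume.restrict Ω) := by
    refine ⟨?_⟩
    rw [Measure.restrict_apply_univ]
    exact (measure_mono subset_closure).trans_lt T.isCompact_closure.measure_lt_top
  have key : ∀ i : Fin d, ∀ᵐ x, x ∈ Ω → g x i - gradient f x i = 0 := fun i => by
    have h1 : Integrable (fun x => g x i) (volume.restrict Ω) :=
      (EuclideanSpace.proj i : E d →L[ℝ] ℝ).integrable_comp (hg.integrable (by norm_num))
    have h2 := (piecewiseContinuous_gradient_apply hΩ hf i).integrable hΩ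
    -- Fundamental lemma of the calculus of variations: both candidates satisfy the same integration
    -- by parts formula.
    refine hopen.ae_eq_zero_of_integral_contDiff_smul_eq_zero
      (IntegrableOn.locallyIntegrableOn (h1.sub h2)) fun φ hφ hφc hφs => ?_
    have hφ' : IsTestFunction Ω φ := ⟨hφ, hφc, hφs⟩
    have ha := hw φ hφ' i
    have hb := integral_fderiv_mul_testFunction hΩ hf hφ' (EuclideanSpace.single i 1)
    simp only [gradient_apply] at ha ⊢
    obtain ⟨M, hM⟩ := hφc.exists_bound_of_continuous hφ.continuous
    have h1' : Integrable (fun x => g x i * φ x) (volume.restrict Ω) :=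
      h1.mul_bdd hφ.continuous.aestronglyMeasurable (Eventually.of_forall hM)
    have h2' : Integrable (fun x => fderiv ℝ f x (EuclideanSpace.single i 1) * φ x)
        (volume.restrict Ω) := by
      simp only [gradient_apply] at h2
      exact h2.mul_bdd hφ.continuous.aestronglyMeasurable (Eventually.of_forall hM)
    rw [← setIntegral_eq_integral_of_forall_compl_eq_zero (s := Ω)]
    · have : ∫ x in Ω, (g x i * φ x - fderiv ℝ f x (EuclideanSpace.single i 1) * φ x) = 0 := by
        rw [integral_sub h1' h2', hb, ha]
        ring
      rw [← this]
      congr 1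
      ext x
      simp only [smul_eq_mul]
      ring
    · intro x hx
      rw [image_eq_zero_of_notMem_tsupport fun h => hx (hφs h), zero_smul]
  refine (ae_restrict_iff' hopen.measurableSet).2 ?_
  filter_upwards [ae_all_iff.2 key] with x hx hxΩ
  ext i
  exact sub_eq_zero.1 (hx i hxΩ)

/-- The unspecified weak gradient in `MemH10` can be replaced by the piecewise one, since they agree
almost everywhere. -/
theorem exists_testFunction_near (hΩ : interior (closure Ω) = Ω) (hf : f ∈ spaceV T p)
    {ε : ℝ≥0∞} (hε : 0 < ε) : ∃ φ : E d → ℝ, IsTestFunction Ω φ ∧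
      eLpNorm (fun x => f x - φ x) 2 (volume.restrict Ω) < ε ∧
      eLpNorm (fun x => gradient f x - gradient φ x) 2 (volume.restrict Ω) < ε := by
  obtain ⟨hfW, g, -, hg, hw, h⟩ := hf
  obtain ⟨φ, hφ, h1, h2⟩ := h ε hε
  refine ⟨φ, hφ, h1, ?_⟩
  rwa [← eLpNorm_congr_ae]
  filter_upwards [ae_eq_gradient_of_hasWeakGradient hΩ hfW hg hw] with x hx
  rw [hx]

/-- A linear identity for test functions and their gradients extends to finite element functions
in `H_0^1`. -/
theorem integral_eq_zero_of_forall_testFunction (hΩ : interior (closure Ω) = Ω)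
    (hf : f ∈ spaceV T p) {a : E d → ℝ} {b : E d → E d} (ha : MemLp a 2 (volume.restrict Ω))
    (hb : MemLp b 2 (volume.restrict Ω))
    (h : ∀ φ, IsTestFunction Ω φ → ∫ x in Ω, (φ x * a x + inner ℝ (gradient φ x) (b x)) = 0) :
    ∫ x in Ω, (f x * a x + inner ℝ (gradient f x) (b x)) = 0 := by
  set μ := volume.restrict Ω
  set I := ∫ x, (f x * a x + inner ℝ (gradient f x) (b x)) ∂μ
  set A := (eLpNorm a 2 μ).toReal
  set B := (eLpNorm b 2 μ).toReal
  have hA : 0 ≤ A := ENNReal.toReal_nonneg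
  have hB : 0 ≤ B := ENNReal.toReal_nonneg
  -- By linearity and the hypothesis on `φ`, only the contribution of `f - φ` remains;
  -- Cauchy–Schwarz bounds it.
  have bound : ∀ ε : ℝ, 0 < ε → |I| ≤ ε * (A + B) := fun ε hε => by
    obtain ⟨φ, hφ, h1, h2⟩ := exists_testFunction_near hΩ hf (ENNReal.ofReal_pos.2 hε)
    have hf1 : MemLp (fun x => f x - φ x) 2 μ :=
      ((piecewiseContinuous_of_mem_spaceW hΩ hf.1).memLp hΩ 2).sub
        ((hφ.1.continuous.piecewiseContinuous (T := T)).memLp hΩ 2)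
    have hφ1 := (hφ.1.continuous.piecewiseContinuous (T := T)).memLp hΩ 2
    have hφ2 := ((continuous_gradient hφ.1).piecewiseContinuous (T := T)).memLp hΩ 2
    have hf2 : MemLp (fun x => gradient f x - gradient φ x) 2 μ :=
      ((piecewiseContinuous_gradient hΩ hf.1).memLp hΩ 2).sub hφ2
    have i1 : Integrable (fun x => (f x - φ x) * a x) μ := hf1.integrable_mul ha
    have i2 := integrable_inner_of_memLp hf2 hb
    have i3 : Integrable (fun x => φ x * a x + inner ℝ (gradient φ x) (b x)) μ :=
      (hφ1.integrable_mul ha).add (integrable_inner_of_memLp hφ2 hb)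
    have i12 : Integrable (fun x => (f x - φ x) * a x +
        inner ℝ (gradient f x - gradient φ x) (b x)) μ := i1.add i2
    have hI : I = ∫ x, (f x - φ x) * a x ∂μ +
        ∫ x, inner ℝ (gradient f x - gradient φ x) (b x) ∂μ := by
      rw [← integral_add i1 i2, ← add_zero (∫ x, _ ∂μ), ← h φ hφ, ← integral_add i12 i3]
      refine integral_congr_ae (Eventually.of_forall fun x => ?_)
      simp only [inner_sub_left]
      ring
    have e1 : |∫ x, (f x - φ x) * a x ∂μ| ≤ ε * A := by
      have := abs_integral_inner_le hf1 ha
      simp only [RCLike.inner_apply, conj_trivial] at this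
      simp only [mul_comm _ (a _)]
      refine this.trans (mul_le_mul_of_nonneg_right ?_ hA)
      exact ENNReal.toReal_le_of_le_ofReal hε.le h1.le
    have e2 : |∫ x, inner ℝ (gradient f x - gradient φ x) (b x) ∂μ| ≤ ε * B :=
      (abs_integral_inner_le hf2 hb).trans (mul_le_mul_of_nonneg_right
        (ENNReal.toReal_le_of_le_ofReal hε.le h2.le) hB)
    rw [hI]
    exact (abs_add_le _ _).trans (by linarith)
  by_contra hne
  have hpos : 0 < |I| := abs_pos.2 hne
  -- The `+ 1` keeps the denominator positive and makes the resulting inequality strict enough to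
  -- contradict `|I| > 0`.
  have := bound (|I| / (A + B + 1)) (by positivity)
  rw [div_mul_eq_mul_div, le_div_iff₀ (by positivity)] at this
  nlinarith

theorem fderiv_fderiv_apply_comm {φ : E d → ℝ} (hφ : ContDiff ℝ ∞ φ) (x u v : E d) :
    fderiv ℝ (fun y => fderiv ℝ φ y u) x v = fderiv ℝ (fun y => fderiv ℝ φ y v) x u := by
  have hd : DifferentiableAt ℝ (fderiv ℝ φ) x :=
    (hφ.fderiv_right (m := ∞) (by simp)).differentiable (by simp) x
  have hs : IsSymmSndFDerivAt ℝ φ x := hφ.contDiffAt.isSymmSndFDerivAt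
    (by simpa using WithTop.coe_le_coe.2 (le_top : (2 : ℕ∞) ≤ ⊤))
  rw [fderiv_clm_apply hd (by fun_prop), fderiv_clm_apply hd (by fun_prop)]
  simpa using hs v u

/-- The stiffness integral is symmetric if one of the functions is in `H_0^1`. -/
theorem integral_gradient_mul_gradient_comm (hΩ : interior (closure Ω) = Ω) (hf : f ∈ spaceV T p)
    {Φ : E d → ℝ} (hΦ : Φ ∈ spaceW T p) (i j : Fin d) :
    ∫ x in Ω, gradient f x i * gradient Φ x j = ∫ x in Ω, gradient f x j * gradient Φ x i := by
  have hi := piecewiseContinuous_gradient_apply hΩ hΦ i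
  have hj := piecewiseContinuous_gradient_apply hΩ hΦ j
  -- Chosen so that pairing with `∇φ` gives the antisymmetric part `∂ᵢφ ∂ⱼΦ - ∂ⱼφ ∂ᵢΦ`.
  let b : E d → E d := fun x =>
    gradient Φ x j • EuclideanSpace.single i 1 - gradient Φ x i • EuclideanSpace.single j 1
  have hb : T.PiecewiseContinuous b := hj.comp₂ hi
    (op := fun s t => s • EuclideanSpace.single i (1 : ℝ) - t • EuclideanSpace.single j (1 : ℝ))
    (by fun_prop)
  have hinner : ∀ (φ : E d → ℝ) x, inner ℝ (gradient φ x) (b x) =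
      gradient φ x i * gradient Φ x j - gradient φ x j * gradient Φ x i := fun φ x => by
    simp only [b, inner_sub_right, inner_smul_right, EuclideanSpace.inner_single_right]
    simp [mul_comm]
  have h := integral_eq_zero_of_forall_testFunction hΩ hf (a := fun _ => 0) (b := b)
    MemLp.zero' (hb.memLp hΩ 2) fun φ hφ => by
      have hpc : ∀ k, T.PiecewiseContinuous fun x => gradient φ x k := fun k => by
        simp only [gradient_apply]
        exact (hφ.fderiv_apply _).1.continuous.piecewiseContinuous
      simp only [mul_zero, zero_add, hinner]
      rw [integral_sub (((hpc i).mul hj).integrable hΩ) (((hpc j).mul hi).integrable hΩ)]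
      simp only [gradient_apply, mul_comm (fderiv ℝ φ _ _)]
      -- The derivative is moved off `Φ`, which is only piecewise smooth, onto the smooth `φ`.
      rw [integral_fderiv_mul_testFunction hΩ hΦ (hφ.fderiv_apply _),
        integral_fderiv_mul_testFunction hΩ hΦ (hφ.fderiv_apply _)]
      simp only [fderiv_fderiv_apply_comm hφ.1 _ (EuclideanSpace.single i 1)]
      ring
  simp only [mul_zero, zero_add, hinner] at h
  have hpc := piecewiseContinuous_gradient_apply hΩ hf.1
  rw [integral_sub (((hpc i).mul hj).integrable hΩ) (((hpc j).mul hi).integrable hΩ)] at h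
  exact sub_eq_zero.1 h

end

section

variable {d : ℕ} {Ω : Set (E d)} {T : Triangulation Ω} {p : ℕ} {f : E d → ℝ}

/-! ### Vanishing traces -/

/-- A quadratic weight that is positive at `x₀` and decreases in the directions in which `ℓ`
grows. -/
def capWeight (ℓ : E d →L[ℝ] ℝ) (x₀ : E d) (δ : ℝ) (x : E d) : ℝ :=
  δ ^ 2 - ‖x - x₀‖ ^ 2 - ℓ (x - x₀)

/-- A small open spherical cap on the hyperplane `ℓ (x - x₀) = 0`. -/
def cap (ℓ : E d →L[ℝ] ℝ) (x₀ : E d) (δ : ℝ) : Set (E d) :=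
  {x | 0 < ℓ (x - x₀) ∧ 0 < capWeight ℓ x₀ δ x}

variable (ℓ : E d →L[ℝ] ℝ) (x₀ : E d) (δ : ℝ)

theorem contDiff_capWeight : ContDiff ℝ ∞ (capWeight ℓ x₀ δ) := by
  unfold capWeight
  exact (contDiff_const.sub ((contDiff_id.sub contDiff_const).norm_sq ℝ)).sub
    (ℓ.contDiff.comp (contDiff_id.sub contDiff_const))

theorem fderiv_capWeight (x v : E d) :
    fderiv ℝ (capWeight ℓ x₀ δ) x v = -(2 * inner ℝ (x - x₀) v) - ℓ v := by
  have h1 : HasFDerivAt (fun x => x - x₀) (ContinuousLinearMap.id ℝ (E d)) x :=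
    (hasFDerivAt_id x).sub_const x₀
  have h2 := (((hasFDerivAt_const (δ ^ 2) x).sub h1.norm_sq).sub (ℓ.hasFDerivAt.comp x h1))
  have h3 : HasFDerivAt (capWeight ℓ x₀ δ) _ x := h2
  rw [h3.fderiv]
  simp [inner_sub_left]

theorem isOpen_cap : IsOpen (cap ℓ x₀ δ) :=
  (isOpen_lt continuous_const (ℓ.continuous.comp (continuous_sub_right x₀))).and
    (isOpen_lt continuous_const (contDiff_capWeight ℓ x₀ δ).continuous)

/-- Convexity serves to make the frontier of the cap a null set. -/
theorem convex_cap : Convex ℝ (cap ℓ x₀ δ) := by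
  have h1 : ConvexOn ℝ univ fun y : E d => ‖y‖ ^ 2 + ℓ y :=
    ((convexOn_norm convex_univ).pow (fun _ _ => norm_nonneg _) 2).add
      (ℓ.toLinearMap.convexOn convex_univ)
  have h2 := (h1.convex_lt (δ ^ 2)).translate_preimage_right (-x₀)
  have h3 := (convex_halfSpace_gt (f := ℓ) ℓ.toLinearMap.isLinear 0).translate_preimage_right (-x₀)
  have h4 : cap ℓ x₀ δ = (fun x => -x₀ + x) ⁻¹' {w | 0 < ℓ w} ∩
      (fun x => -x₀ + x) ⁻¹' {x | x ∈ univ ∧ ‖x‖ ^ 2 + ℓ x < δ ^ 2} := by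
    ext x
    simp only [cap, capWeight, mem_ofPred_eq, mem_inter_iff, mem_preimage, mem_univ, true_and,
      neg_add_eq_sub]
    constructor <;> rintro ⟨h, h'⟩ <;> exact ⟨h, by linarith⟩
  rw [h4]
  exact h3.inter h2

theorem norm_sub_le_of_capWeight_nonneg {ℓ : E d →L[ℝ] ℝ} {x₀ x : E d} {δ : ℝ} (hδ : 0 ≤ δ)
    (h1 : 0 ≤ ℓ (x - x₀)) (h2 : 0 ≤ capWeight ℓ x₀ δ x) : ‖x - x₀‖ ≤ δ := by
  unfold capWeight at h2
  exact abs_le_of_sq_le_sq' (by linarith) hδ |>.2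

/-- On the flat part of the cap's boundary `φ` vanishes, on the curved part the weight does. Hence
the product extended by zero is Lipschitz with compact support, and its line derivative integrates
to zero. -/
theorem integral_cap_fderiv_eq_zero {ℓ : E d →L[ℝ] ℝ} {x₀ : E d} {δ : ℝ} (hδ : 0 ≤ δ)
    {φ : E d → ℝ} (hφ : ContDiff ℝ ∞ φ)
    (h0 : ∀ x, ‖x - x₀‖ ≤ δ → ℓ (x - x₀) = 0 → φ x = 0) (v : E d) :
    ∫ x in cap ℓ x₀ δ, fderiv ℝ (fun y => φ y * capWeight ℓ x₀ δ y) x v = 0 := by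
  set q := capWeight ℓ x₀ δ with hq
  have hqc : ContDiff ℝ ∞ q := contDiff_capWeight ℓ x₀ δ
  set O := cap ℓ x₀ δ with hO
  have hsm : ContDiff ℝ ∞ fun y => φ y * q y := hφ.mul hqc
  have hopen : IsOpen O := isOpen_cap ℓ x₀ δ
  set F : E d → ℝ := O.indicator fun y => φ y * q y with hF
  set A : Set (E d) := {x | 0 ≤ ℓ (x - x₀) ∧ 0 ≤ q x} with hA
  have hAball : A ⊆ Metric.closedBall x₀ δ := fun x hx => by
    rw [mem_closedBall_iff_norm]
    exact norm_sub_le_of_capWeight_nonneg hδ hx.1 hx.2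
  have hOA : O ⊆ A := fun x hx => ⟨hx.1.le, hx.2.le⟩
  have hFA : EqOn F (fun y => φ y * q y) A := fun x hx => by
    by_cases hxO : x ∈ O
    · simp [hF, hxO]
    · have : ℓ (x - x₀) = 0 ∨ q x = 0 := by
        by_contra! h
        exact hxO ⟨lt_of_le_of_ne hx.1 h.1.symm, lt_of_le_of_ne hx.2 h.2.symm⟩
      rcases this with h | h
      · simp [hF, hxO, h0 x (norm_sub_le_of_capWeight_nonneg hδ hx.1 hx.2) h]
      · simp [hF, hxO, h]
  obtain ⟨K, hK⟩ : ∃ K : ℝ≥0, LipschitzWith K F := by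
    refine lipschitzWith_of_finite_closed_cover (fun b : Bool => if b then A else Oᶜ) ?_ ?_ F ?_
    · rintro (_ | _)
      · exact hopen.isClosed_compl
      · exact (isClosed_le continuous_const (ℓ.continuous.comp (continuous_sub_right x₀))).and
          (isClosed_le continuous_const hqc.continuous)
    · refine eq_univ_of_forall fun x => mem_iUnion.2 ?_
      by_cases hx : x ∈ O
      · exact ⟨true, hOA hx⟩
      · exact ⟨false, hx⟩
    · rintro (_ | _)
      · refine ⟨0, fun x hx y hy => ?_⟩
        have hx' : x ∉ O := hx
        have hy' : y ∉ O := hy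
        simp [hF, hx', hy']
      · obtain ⟨K, hK⟩ := hsm.contDiffOn.exists_lipschitzOnWith (by simp)
          (convex_closedBall x₀ δ) (isCompact_closedBall x₀ δ)
        refine ⟨K, fun x hx y hy => ?_⟩
        rw [hFA hx, hFA hy]
        exact hK (hAball hx) (hAball hy)
  have hc : HasCompactSupport F := HasCompactSupport.intro (isCompact_closedBall x₀ δ) fun x hx =>
    indicator_of_notMem (fun h => hx (hAball (hOA h))) _
  have h := integral_lineDeriv_eq_zero hK hc v
  rw [← h, ← integral_indicator hopen.measurableSet]
  refine integral_congr_ae ?_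
  have hfr : ∀ᵐ x : E d, x ∉ frontier O :=
    measure_eq_zero_iff_ae_notMem.1 ((convex_cap ℓ x₀ δ).addHaar_frontier volume)
  filter_upwards [hfr] with x hx
  by_cases hxO : x ∈ O
  · have hev : F =ᶠ[𝓝 x] fun y => φ y * q y := by
      filter_upwards [hopen.mem_nhds hxO] with y hy
      exact indicator_of_mem hy _
    rw [hev.lineDeriv_eq, indicator_of_mem hxO,
      (hsm.differentiable (by simp) x).lineDeriv_eq_fderiv]
  · have hxc : x ∉ closure O := fun h => hx (by
      rw [hopen.frontier_eq]
      exact ⟨h, hxO⟩)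
    have hev : F =ᶠ[𝓝 x] fun _ => 0 := by
      filter_upwards [isClosed_closure.isOpen_compl.mem_nhds hxc] with y hy
      exact indicator_of_notMem (fun h => hy (subset_closure h)) _
    rw [hev.lineDeriv_eq, indicator_of_notMem hxO]
    simp [lineDeriv]

/-- A finite element function in `H_0^1` vanishes at a boundary point near which the boundary is a
hyperplane, when approached from inside. -/
theorem eq_zero_of_halfBall (hΩ : interior (closure Ω) = Ω) (hf : f ∈ spaceV T p)
    {s : Finset (E d)} (hs : s ∈ T.cells) {G : E d → ℝ} (hG : ContDiff ℝ ∞ G)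
    (hfG : EqOn f G (cell s)) {ℓ : E d →L[ℝ] ℝ} {x₀ v : E d} (hv : ℓ v = 1) {r : ℝ} (hr : 0 < r)
    (hin : ∀ x, ‖x - x₀‖ ≤ r → 0 < ℓ (x - x₀) → x ∈ cell s)
    (hbd : ∀ x, ‖x - x₀‖ ≤ r → ℓ (x - x₀) = 0 → x ∉ Ω) : G x₀ = 0 := by
  by_contra hne
  have hsq : 0 < G x₀ * G x₀ := mul_self_pos.2 hne
  have hGc := hG.continuous
  have hG'c : Continuous fun x => fderiv ℝ G x v :=
    (hG.continuous_fderiv (by simp)).clm_apply continuous_const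
  have ev1 : ∀ᶠ x in 𝓝 x₀, G x₀ * G x₀ / 2 < G x₀ * G x :=
    (by fun_prop : Continuous fun x => G x₀ * G x).continuousAt.eventually_const_lt (by linarith)
  set M := |G x₀ * fderiv ℝ G x₀ v| + 1 with hM
  have hMpos : 0 < M := by positivity
  have ev2 : ∀ᶠ x in 𝓝 x₀, G x₀ * fderiv ℝ G x v < M :=
    (by fun_prop : Continuous fun x => G x₀ * fderiv ℝ G x v).continuousAt.eventually_lt_const
      (by linarith [le_abs_self (G x₀ * fderiv ℝ G x₀ v)])
  obtain ⟨r', hr', hball⟩ := Metric.eventually_nhds_iff.1 (ev1.and ev2)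
  -- The bound on `2δ‖v‖` forces `∂ᵥq < -1/2` on the cap; the bound on `Mδ²` makes the term `q ∂ᵥG`
  -- too small to compensate for `G ∂ᵥq`.
  obtain ⟨δ, hδ, hδr, hδr', hδv, hδM⟩ : ∃ δ : ℝ, 0 < δ ∧ δ < r ∧ δ < r' ∧ 2 * δ * ‖v‖ < 1 / 2 ∧
      M * δ ^ 2 < G x₀ * G x₀ / 4 := by
    have c1 : ∀ᶠ δ : ℝ in 𝓝 0, 2 * δ * ‖v‖ < 1 / 2 :=
      (by fun_prop : Continuous fun δ : ℝ => 2 * δ * ‖v‖).continuousAt.eventually_lt_const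
        (by simp)
    have c2 : ∀ᶠ δ : ℝ in 𝓝 0, M * δ ^ 2 < G x₀ * G x₀ / 4 :=
      (by fun_prop : Continuous fun δ : ℝ => M * δ ^ 2).continuousAt.eventually_lt_const
        (by simpa using hsq)
    have c3 : ∀ᶠ δ : ℝ in 𝓝[>] 0, δ < r ∧ δ < r' ∧ 2 * δ * ‖v‖ < 1 / 2 ∧
        M * δ ^ 2 < G x₀ * G x₀ / 4 :=
      nhdsWithin_le_nhds ((eventually_lt_nhds hr).and ((eventually_lt_nhds hr').and (c1.and c2)))
    obtain ⟨δ, h, h'⟩ := (c3.and self_mem_nhdsWithin).exists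
    exact ⟨δ, h', h⟩
  set q := capWeight ℓ x₀ δ with hq
  have hqc : ContDiff ℝ ∞ q := contDiff_capWeight ℓ x₀ δ
  have hq'c : Continuous fun x => fderiv ℝ q x v :=
    (hqc.continuous_fderiv (by simp)).clm_apply continuous_const
  set O := cap ℓ x₀ δ with hO
  have hopen : IsOpen O := isOpen_cap ℓ x₀ δ
  have hnorm : ∀ x ∈ O, ‖x - x₀‖ ≤ δ := fun x hx =>
    norm_sub_le_of_capWeight_nonneg hδ.le hx.1.le hx.2.le
  have hOcell : O ⊆ cell s := fun x hx => hin x ((hnorm x hx).trans hδr.le) hx.1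
  have hOΩ : O ⊆ Ω := hOcell.trans (T.cell_subset hΩ hs)
  have hneg : ∀ x ∈ O, G x₀ * (fderiv ℝ (fun y => G y * q y) x v) < 0 := fun x hx => by
    have hxn := hnorm x hx
    obtain ⟨b1, b2⟩ := hball (show dist x x₀ < r' by rw [dist_eq_norm]; linarith)
    have hq0 : 0 < q x := hx.2
    have hq1 : q x ≤ δ ^ 2 := by
      have := hx.1
      simp only [hq, capWeight]
      nlinarith [sq_nonneg ‖x - x₀‖]
    have hq2 : fderiv ℝ q x v < -(1 / 2) := by
      rw [hq, fderiv_capWeight, hv]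
      have := neg_le_of_abs_le ((abs_real_inner_le_norm (x - x₀) v).trans
        (mul_le_mul_of_nonneg_right hxn (norm_nonneg v)))
      linarith
    rw [fderiv_fun_mul (hG.differentiable (by simp) x) (hqc.differentiable (by simp) x)]
    simp only [add_apply, smul_apply, smul_eq_mul]
    have e1 : q x * (G x₀ * fderiv ℝ G x v) ≤ M * δ ^ 2 :=
      (mul_le_mul_of_nonneg_left b2.le hq0.le).trans (by nlinarith)
    have e2 : (G x₀ * G x) * fderiv ℝ q x v ≤ -(G x₀ * G x₀ / 4) := by nlinarith
    nlinarith
  -- The cap identity for test functions passes to `f` by density, and `f = G` on the cap. It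
  -- contradicts the strict sign in `hneg`, the cap being open and nonempty.
  have hzero : ∫ x in O, fderiv ℝ (fun y => G y * q y) x v = 0 := by
    have hbdd : ∀ {F : Type} [NormedAddCommGroup F] {g : E d → F}, Continuous g →
        MemLp (O.indicator g) 2 (volume.restrict Ω) := fun hg =>
      ((hg.piecewiseContinuous (T := T)).memLp hΩ 2).indicator hopen.measurableSet
    have hident : ∀ {g : E d → ℝ}, (∀ x ∈ O, DifferentiableAt ℝ g x) →
        ∫ x in Ω, (g x * O.indicator (fun x => fderiv ℝ q x v) x +
          inner ℝ (gradient g x) (O.indicator (fun x => q x • v) x)) =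
        ∫ x in O, fderiv ℝ (fun y => g y * q y) x v := fun {g} hg => by
      rw [← integral_indicator hopen.measurableSet,
        ← setIntegral_eq_integral_of_forall_compl_eq_zero
          (fun x hx => indicator_of_notMem (fun h => hx (hOΩ h)) _)]
      refine integral_congr_ae (Eventually.of_forall fun x => ?_)
      by_cases hx : x ∈ O
      · simp only [indicator_of_mem hx]
        rw [fderiv_fun_mul (hg x hx) (hqc.differentiable (by simp) x), inner_smul_right,
          inner_gradient]
        simp only [add_apply, smul_apply, smul_eq_mul]
      · simp [indicator_of_notMem hx]
    have h := integral_eq_zero_of_forall_testFunction hΩ hf (hbdd hq'c)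
      (hbdd (g := fun x => q x • v) (hqc.continuous.smul continuous_const)) fun φ hφ => by
        rw [hident fun x _ => hφ.1.differentiable (by simp) x]
        refine integral_cap_fderiv_eq_zero hδ.le hφ.1 (fun x hx hx0 => ?_) v
        exact image_eq_zero_of_notMem_tsupport fun h =>
          hbd x (hx.trans hδr.le) hx0 (hφ.2.2 h)
    rw [hident fun x hx => (hG.differentiable (by simp) x).congr_of_eventuallyEq
      (eventuallyEq_of_eqOn_cell hfG (hOcell hx))] at h
    rw [← h]
    refine setIntegral_congr_fun hopen.measurableSet fun x hx => ?_
    have hev : (fun y => f y * q y) =ᶠ[𝓝 x] fun y => G y * q y := by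
      filter_upwards [eventuallyEq_of_eqOn_cell hfG (hOcell hx)] with y hy
      rw [hy]
    simp only [hev.fderiv_eq]
  have hcont : Continuous fun x => fderiv ℝ (fun y => G y * q y) x v :=
    ((hG.mul hqc).continuous_fderiv (by simp)).clm_apply continuous_const
  have hint : IntegrableOn (fun x => -(G x₀ * fderiv ℝ (fun y => G y * q y) x v)) O volume :=
    ((continuous_const.mul hcont).neg.continuousOn.integrableOn_compact
      (isCompact_closedBall x₀ δ)).mono_set fun x hx => by
        rw [mem_closedBall_iff_norm]
        exact hnorm x hx
  have hint0 : ∫ x in O, -(G x₀ * fderiv ℝ (fun y => G y * q y) x v) = 0 := by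
    rw [integral_neg, integral_const_mul, hzero, mul_zero, neg_zero]
  rw [setIntegral_eq_zero_iff_of_nonneg_ae ?_ hint] at hint0
  · have hO0 : volume O = 0 := by
      have h1 := (ae_restrict_iff' hopen.measurableSet).1 hint0
      refine measure_eq_zero_iff_ae_notMem.2 ?_
      filter_upwards [h1] with x hx hxO
      have := hneg x hxO
      have := hx hxO
      simp only [Pi.zero_apply] at this
      linarith
    refine (hopen.measure_pos volume ?_).ne' hO0
    have c : ∀ᶠ t : ℝ in 𝓝[>] 0, 0 < δ ^ 2 - (t * ‖v‖) ^ 2 - t :=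
      nhdsWithin_le_nhds ((by fun_prop : Continuous fun t : ℝ =>
        δ ^ 2 - (t * ‖v‖) ^ 2 - t).continuousAt.eventually_const_lt (by simpa using pow_pos hδ 2))
    obtain ⟨t, ht, ht0⟩ := (c.and self_mem_nhdsWithin).exists
    have ht0' : 0 < t := ht0
    refine ⟨x₀ + t • v, ?_, ?_⟩
    · simpa [hv] using ht0'
    · simpa [capWeight, hv, norm_smul, abs_of_pos ht0'] using ht
  · exact (ae_restrict_iff' hopen.measurableSet).2 (Eventually.of_forall fun x hx => by
      simpa using (hneg x hx).le)

end

section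

variable {d : ℕ} {Ω : Set (E d)} {T : Triangulation Ω} {p : ℕ} {f : E d → ℝ}

/-! ### Facets -/

theorem facet_subset (s : Finset (E d)) (w : E d) : facet s w ⊆ s := Finset.erase_subset _ _

theorem closedCell_facet_subset (s : Finset (E d)) (w : E d) :
    closedCell (facet s w) ⊆ closedCell s :=
  convexHull_mono (Finset.coe_subset.2 (facet_subset s w))

namespace Triangulation

variable (T)

/-- The vertices of a simplex of the triangulation as an affine basis. -/
def basis {s : Finset (E d)} (hs : s ∈ T.cells) : AffineBasis s ℝ (E d) :=
  ⟨(↑), T.affineIndependent s hs, by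
    rw [(T.affineIndependent s hs).affineSpan_eq_top_iff_card_eq_finrank_add_one]
    simp [T.card_eq s hs]⟩

variable {T}
variable {s : Finset (E d)} (hs : s ∈ T.cells)

theorem range_basis : range (T.basis hs) = s := Subtype.range_coe

theorem closedCell_eq : closedCell s = {x | ∀ v, 0 ≤ (T.basis hs).coord v x} := by
  rw [closedCell, ← range_basis hs, AffineBasis.convexHull_eq_nonneg_coord]

theorem cell_eq : cell s = {x | ∀ v, 0 < (T.basis hs).coord v x} := by
  rw [cell, closedCell, ← range_basis hs, AffineBasis.interior_convexHull]

theorem mem_closedCell_facet_iff (w : s) (x : E d) :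
    x ∈ closedCell (facet s w) ↔
      (∀ v, 0 ≤ (T.basis hs).coord v x) ∧ (T.basis hs).coord w x = 0 := by
  set b := T.basis hs
  constructor
  · intro hx
    have h1 : x ∈ closedCell s := closedCell_facet_subset s w hx
    rw [closedCell_eq hs] at h1
    refine ⟨h1, ?_⟩
    have hconv : Convex ℝ (b.coord w ⁻¹' {0}) := (convex_singleton (0 : ℝ)).affine_preimage _
    refine convexHull_min (fun v hv => ?_) hconv hx
    have hv' : v ≠ w ∧ v ∈ s := by
      rw [facet, Finset.mem_coe, Finset.mem_erase] at hv
      exact hv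
    have := b.coord_apply_ne (i := w) (j := ⟨v, hv'.2⟩) fun h => hv'.1 (by rw [h])
    exact this
  · rintro ⟨h1, h2⟩
    classical
    rw [← b.linear_combination_coord_eq_self x, ← Finset.sum_erase (a := w) Finset.univ
      (by rw [h2, zero_smul])]
    refine (convex_closedCell (facet s w)).sum_mem (fun v _ => h1 v) ?_ fun v hv => ?_
    · rw [Finset.sum_erase (f := fun v => b.coord v x) _ h2, b.sum_coord_apply_eq_one]
    · refine subset_convexHull ℝ _ ?_
      have hvw : v ≠ w := Finset.ne_of_mem_erase hv
      rw [facet, Finset.mem_coe, Finset.mem_erase]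
      exact ⟨fun h => hvw (Subtype.ext h), v.2⟩

end Triangulation

/-- The trace of a finite element function in `H_0^1` on a facet contained in the boundary is
zero. -/
theorem eqOn_zero_closedCell_facet (hd : 1 ≤ d) (hΩ : interior (closure Ω) = Ω)
    (hf : f ∈ spaceV T p) {s : Finset (E d)} (hs : s ∈ T.cells) {G : E d → ℝ}
    (hG : ContDiff ℝ ∞ G) (hfG : EqOn f G (cell s)) {w : E d} (hw : w ∈ s)
    (hwΩ : closedCell (facet s w) ⊆ frontier Ω) {x : E d} (hx : x ∈ closedCell (facet s w)) :
    G x = 0 := by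
  classical
  have hopen : IsOpen Ω := hΩ ▸ isOpen_interior
  set b := T.basis hs with hb
  set w' : s := ⟨w, hw⟩ with hw'
  have hmem := Triangulation.mem_closedCell_facet_iff hs w'
  have hcont : ∀ v, Continuous (b.coord v) := fun v => continuous_barycentric_coord b v
  -- Near a relative interior point of the facet, the cell is the half-space where the barycentric
  -- coordinate of `w` is positive; its linear part is `ℓ`, normalised by the direction `w - x₀`.
  have interior_case : ∀ x₀, (∀ v, v ≠ w' → 0 < b.coord v x₀) → b.coord w' x₀ = 0 → G x₀ = 0 := by
    intro x₀ h1 h2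
    set ℓ : E d →L[ℝ] ℝ := (b.coord w').linear.toContinuousLinearMap
    have hℓ : ∀ x, ℓ (x - x₀) = b.coord w' x := fun x => by
      have := (b.coord w').linearMap_vsub x x₀
      rw [vsub_eq_sub, vsub_eq_sub, h2, sub_zero] at this
      exact this
    have hev : ∀ᶠ x in 𝓝 x₀, ∀ v, v ≠ w' → 0 < b.coord v x := by
      refine eventually_all.2 fun v => ?_
      by_cases hv : v = w'
      · simp [hv]
      · filter_upwards [(hcont v).continuousAt.eventually_const_lt (h1 v hv)] with x hx _ using hx
    obtain ⟨r, hr, hball⟩ := Metric.nhds_basis_closedBall.eventually_iff.1 hev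
    refine eq_zero_of_halfBall hΩ hf hs hG hfG (ℓ := ℓ) (v := w - x₀) ?_ hr (fun x hx hpos => ?_)
      fun x hx h0 hxΩ => ?_
    · rw [hℓ]
      exact b.coord_apply_eq w'
    · rw [Triangulation.cell_eq hs]
      intro v
      by_cases hv : v = w'
      · rw [hv, ← hb, ← hℓ]
        exact hpos
      · exact hball (by rwa [mem_closedBall_iff_norm]) v hv
    · rw [hℓ] at h0
      have hxf : x ∈ closedCell (facet s w) := (hmem x).2 ⟨fun v => by
        by_cases hv : v = w'
        · rw [hv, ← hb, h0]
        · exact (hball (by rwa [mem_closedBall_iff_norm]) v hv).le, h0⟩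
      have := hwΩ hxf
      rw [hopen.frontier_eq] at this
      exact this.2 hxΩ
  have hcard : 0 < (Finset.univ.erase w').card := by
    rw [Finset.card_erase_of_mem (Finset.mem_univ _), Finset.card_univ, Fintype.card_coe,
      T.card_eq s hs]
    omega
  -- The open segment from any facet point to the centroid lies in the relative interior, so
  -- continuity of `G` handles the remaining points.
  set c := (Finset.univ.erase w').centroid ℝ b with hc
  have hcw : b.coord w' c = 0 :=
    b.coord_apply_combination_of_notMem (by simp)
      (Finset.sum_centroidWeights_eq_one_of_card_ne_zero ℝ _ hcard.ne')
  have hcv : ∀ v, v ≠ w' → 0 < b.coord v c := fun v hv => by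
    rw [hc, b.coord_apply_centroid (Finset.mem_erase.2 ⟨hv, Finset.mem_univ _⟩)]
    positivity
  obtain ⟨hx1, hx2⟩ := (hmem x).1 hx
  have hline : Continuous fun t : ℝ => G (AffineMap.lineMap x c t) :=
    hG.continuous.comp AffineMap.lineMap_continuous
  have hlim : Tendsto (fun t : ℝ => G (AffineMap.lineMap x c t)) (𝓝[>] 0) (𝓝 (G x)) := by
    have := hline.tendsto 0
    rw [AffineMap.lineMap_apply_zero] at this
    exact this.mono_left nhdsWithin_le_nhds
  refine tendsto_nhds_unique hlim (tendsto_const_nhds.congr' ?_)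
  filter_upwards [Ioo_mem_nhdsGT (zero_lt_one' ℝ)] with t ht
  refine (interior_case _ (fun v hv => ?_) ?_).symm
  · rw [AffineMap.apply_lineMap, AffineMap.lineMap_apply_module]
    have := hx1 v
    have h3 := hcv v hv
    have := mul_nonneg (sub_nonneg.2 ht.2.le) this
    have := mul_pos ht.1 h3
    simp only [smul_eq_mul]
    linarith
  · rw [AffineMap.apply_lineMap, AffineMap.lineMap_apply_module, hcw, hx2]
    simp

theorem finrank_vectorSpan_facet (T : Triangulation Ω) (hd : 1 ≤ d) {s : Finset (E d)}
    (hs : s ∈ T.cells) {w : E d} (hw : w ∈ s) :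
    Module.finrank ℝ (vectorSpan ℝ (facet s w : Set (E d))) = d - 1 := by
  have hi : AffineIndependent ℝ ((↑) : facet s w → E d) :=
    (T.affineIndependent s hs).mono (Finset.coe_subset.2 (facet_subset s w))
  have hc : Fintype.card (facet s w) = (d - 1) + 1 := by
    rw [Fintype.card_coe, facet, Finset.card_erase_of_mem hw, T.card_eq s hs]
    omega
  have hr : vectorSpan ℝ (range ((↑) : facet s w → E d)) = vectorSpan ℝ (facet s w : Set (E d)) := by
    congr 1
    exact Subtype.range_coe
  rw [← (LinearEquiv.ofEq _ _ hr).finrank_eq]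
  exact hi.finrank_vectorSpan hc

/-- On a boundary facet the gradient of a finite element function in `H_0^1` is parallel to the
normal. -/
theorem gradient_mul_outwardNormal_comm (hd : 1 ≤ d) (hΩ : interior (closure Ω) = Ω)
    (hf : f ∈ spaceV T p) {s : Finset (E d)} (hs : s ∈ T.cells) {G : E d → ℝ}
    (hG : ContDiff ℝ ∞ G) (hfG : EqOn f G (cell s)) {w : E d} (hw : w ∈ s)
    (hwΩ : closedCell (facet s w) ⊆ frontier Ω) {x : E d} (hx : x ∈ closedCell (facet s w))
    (i j : Fin d) :
    gradient G x i * outwardNormal s w j = gradient G x j * outwardNormal s w i := by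
  set S := vectorSpan ℝ (facet s w : Set (E d)) with hS
  -- `G` vanishes on the segment from `x` to the vertex `u`. As `x` may lie on the rim of the facet,
  -- only a one-sided derivative is available.
  have hzero : ∀ u ∈ facet s w, fderiv ℝ G x (u - x) = 0 := fun u hu => by
    have hu' : u ∈ closedCell (facet s w) := subset_convexHull ℝ _ hu
    have h1 : HasDerivAt (fun t : ℝ => x + t • (u - x)) (u - x) 0 := by
      simpa using ((hasDerivAt_id (0 : ℝ)).smul_const (u - x)).const_add x
    have h2 : HasDerivAt (fun t : ℝ => G (x + t • (u - x))) (fderiv ℝ G x (u - x)) 0 := by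
      refine HasFDerivAt.comp_hasDerivAt (0 : ℝ) ?_ h1
      simpa using (hG.differentiable (by simp) x).hasFDerivAt
    have h3 : HasDerivWithinAt (fun t : ℝ => G (x + t • (u - x))) 0 (Icc 0 1) 0 := by
      refine (hasDerivWithinAt_const (0 : ℝ) (Icc 0 1) (0 : ℝ)).congr_of_mem (fun t ht => ?_)
        (left_mem_Icc.2 zero_le_one)
      exact eqOn_zero_closedCell_facet hd hΩ hf hs hG hfG hw hwΩ
        ((convex_closedCell _).add_smul_sub_mem hx hu' ht)
    exact (uniqueDiffOn_Icc zero_lt_one 0 (left_mem_Icc.2 zero_le_one)).eq_deriv _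
      h2.hasDerivWithinAt h3
  have hgrad : gradient G x ∈ Sᗮ := by
    have hle : S ≤ LinearMap.ker (fderiv ℝ G x).toLinearMap := by
      rw [hS, vectorSpan, Submodule.span_le]
      rintro _ ⟨u, hu, u', hu', rfl⟩
      have : u -ᵥ u' = (u - x) - (u' - x) := by simp
      simp only [SetLike.mem_coe, LinearMap.mem_ker, this]
      rw [map_sub, ContinuousLinearMap.coe_coe, hzero u hu, hzero u' hu', sub_zero]
    refine (Submodule.mem_orthogonal' _ _).2 fun y hy => ?_
    rw [inner_gradient]
    exact hle hy
  have hn : outwardNormal s w ∈ Sᗮ :=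
    Submodule.smul_mem _ _ (Submodule.starProjection_apply_mem _ _)
  -- A zero normal would make both sides vanish, so its nonvanishing need not be proved.
  rcases eq_or_ne (outwardNormal s w) 0 with h0 | h0
  · simp [h0]
  · have hrank : Module.finrank ℝ Sᗮ = 1 := by
      have h1 := S.finrank_add_finrank_orthogonal
      rw [finrank_vectorSpan_facet T hd hs hw, finrank_euclideanSpace_fin] at h1
      omega
    obtain ⟨c, hc⟩ := (finrank_eq_one_iff_of_nonzero' (⟨outwardNormal s w, hn⟩ : Sᗮ)
      (by simpa using h0)).1 hrank ⟨gradient G x, hgrad⟩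
    have hc' : c • outwardNormal s w = gradient G x := congrArg Subtype.val hc
    rw [← hc']
    simp only [PiLp.smul_apply, smul_eq_mul]
    ring

/-- The facet is the isometric image of a compact subset of its direction space, whose dimension is
exactly `d - 1`. -/
theorem euclideanHausdorffMeasure_closedCell_facet_lt_top (T : Triangulation Ω) (hd : 1 ≤ d)
    {s : Finset (E d)} (hs : s ∈ T.cells) {w : E d} (hw : w ∈ s) :
    Measure.euclideanHausdorffMeasure (d - 1) (closedCell (facet s w)) < ⊤ := by
  set S := vectorSpan ℝ (facet s w : Set (E d)) with hS
  have hne : (facet s w).Nonempty := by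
    rw [← Finset.card_pos, facet, Finset.card_erase_of_mem hw, T.card_eq s hs]
    omega
  obtain ⟨u, hu⟩ := hne
  let j : S → E d := fun y => (y : E d) + u
  have hj : Isometry j := (isometry_add_right u).comp isometry_subtype_coe
  have himage : closedCell (facet s w) ⊆ range j := fun x hx => by
    have hx' : x ∈ affineSpan ℝ (facet s w : Set (E d)) := convexHull_subset_affineSpan _ hx
    have hu' : u ∈ affineSpan ℝ (facet s w : Set (E d)) := subset_affineSpan ℝ _ hu
    have := AffineSubspace.vsub_mem_direction hx' hu'
    rw [direction_affineSpan] at this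
    exact ⟨⟨x -ᵥ u, this⟩, by simp [j]⟩
  rw [← image_preimage_eq_of_subset himage, hj.euclideanHausdorffMeasure_image,
    ← finrank_vectorSpan_facet T hd hs hw]
  exact (hj.isClosedEmbedding.isCompact_preimage (isCompact_closedCell _)).measure_lt_top

/-! ### Boundary integrals -/

/-- Turns the limits from inside a cell into values of the smooth extension. -/
theorem extendFrom_cell_eq {F : Type*} [TopologicalSpace F] [T2Space F] {g G : E d → F}
    {s : Finset (E d)} (hs : s ∈ T.cells) (hG : Continuous G) (h : EqOn g G (cell s)) {x : E d}
    (hx : x ∈ closedCell s) : extendFrom (cell s) g x = G x := by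
  refine extendFrom_eq (T.closedCell_subset_closure_cell hs hx) ?_
  refine ((hG.tendsto x).mono_left nhdsWithin_le_nhds).congr' ?_
  filter_upwards [self_mem_nhdsWithin] with y hy using (h hy).symm

/-- The boundary integral is symmetric if the differentiated function is in `H_0^1`. -/
theorem boundaryIntegral_transpose (hd : 1 ≤ d) (hΩ : interior (closure Ω) = Ω)
    (hf : f ∈ spaceV T p) (Φ : E d → ℝ) :
    (boundaryIntegral T f Φ).transpose = boundaryIntegral T f Φ := by
  ext i j
  simp only [boundaryIntegral, Matrix.transpose_apply, Matrix.of_apply]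
  refine Finset.sum_congr rfl fun s hs => Finset.sum_congr rfl fun w hw => ?_
  classical
  rw [Finset.mem_filter] at hw
  obtain ⟨hw, hwΩ⟩ := hw
  obtain ⟨G, hG, hfG, -⟩ := exists_contDiff_of_mem_spaceW hΩ hf.1 hs
  refine setIntegral_congr_fun (isCompact_closedCell _).measurableSet fun x hx => ?_
  have hx' := closedCell_facet_subset s w hx
  simp only [extendFrom_cell_eq hs (continuous_gradient hG) (eqOn_gradient hfG) hx']
  rw [gradient_mul_outwardNormal_comm hd hΩ hf hs hG hfG hw hwΩ hx]

end

section

variable {d : ℕ} {Ω : Set (E d)} {T : Triangulation Ω} {p : ℕ} {f : E d → ℝ}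

/-! ### The finite element space as an inner product space -/

theorem add_mem_spaceW {f g : E d → ℝ} (hf : f ∈ spaceW T p) (hg : g ∈ spaceW T p) :
    f + g ∈ spaceW T p := by
  refine ⟨fun s hs => ?_, hf.2.add hg.2⟩
  obtain ⟨P, hP, hfP⟩ := hf.1 s hs
  obtain ⟨Q, hQ, hgQ⟩ := hg.1 s hs
  exact ⟨P + Q, (MvPolynomial.totalDegree_add P Q).trans (max_le hP hQ), fun x hx => by
    simp [hfP x hx, hgQ x hx]⟩

theorem smul_mem_spaceW (c : ℝ) (hf : f ∈ spaceW T p) : c • f ∈ spaceW T p := by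
  refine ⟨fun s hs => ?_, hf.2.const_smul c⟩
  obtain ⟨P, hP, hfP⟩ := hf.1 s hs
  exact ⟨c • P, (MvPolynomial.totalDegree_smul_le c P).trans hP, fun x hx => by
    simp [hfP x hx, MvPolynomial.smul_eval]⟩

theorem zero_mem_spaceW : (0 : E d → ℝ) ∈ spaceW T p :=
  ⟨fun _ _ => ⟨0, by simp, fun x _ => by simp⟩, continuousOn_const⟩

theorem mem_spaceW_congr (hΩ : interior (closure Ω) = Ω) {f g : E d → ℝ} (hf : f ∈ spaceW T p)
    (h : EqOn g f Ω) : g ∈ spaceW T p := by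
  refine ⟨fun s hs => ?_, hf.2.congr h⟩
  obtain ⟨P, hP, hfP⟩ := hf.1 s hs
  exact ⟨P, hP, fun x hx => (h (T.cell_subset hΩ hs hx)).trans (hfP x hx)⟩

theorem eqOn_zero_of_ae_eq_zero (hΩ : interior (closure Ω) = Ω) (hf : f ∈ spaceW T p)
    (h : f =ᵐ[volume.restrict Ω] 0) : EqOn f 0 Ω :=
  Measure.eqOn_open_of_ae_eq h (hΩ ▸ isOpen_interior) hf.2 continuousOn_const

theorem eqOn_zero_of_integral_mul_self (hΩ : interior (closure Ω) = Ω) (hf : f ∈ spaceW T p)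
    (h : ∫ x in Ω, f x * f x = 0) : EqOn f 0 Ω := by
  have hp := piecewiseContinuous_of_mem_spaceW hΩ hf
  refine eqOn_zero_of_ae_eq_zero hΩ hf ?_
  rw [integral_eq_zero_iff_of_nonneg (fun x => mul_self_nonneg (f x))
    ((hp.mul hp).integrable hΩ)] at h
  filter_upwards [h] with x hx
  simpa using hx

/-- The functions of `𝕎`, represented by functions that vanish outside `Ω`. -/
def submoduleW (T : Triangulation Ω) (p : ℕ) : Submodule ℝ (E d → ℝ) where
  carrier := {f | f ∈ spaceW T p ∧ ∀ x ∉ Ω, f x = 0}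
  add_mem' hf hg := ⟨add_mem_spaceW hf.1 hg.1, fun x hx => by simp [hf.2 x hx, hg.2 x hx]⟩
  zero_mem' := ⟨zero_mem_spaceW, fun _ _ => rfl⟩
  smul_mem' c _ hf := ⟨smul_mem_spaceW c hf.1, fun x hx => by simp [hf.2 x hx]⟩

/-- The function that is equal to a given polynomial on a cell and vanishes outside. -/
def cellPolynomial (s : Finset (E d)) : MvPolynomial (Fin d) ℝ →ₗ[ℝ] E d → ℝ where
  toFun P := (cell s).indicator fun x => MvPolynomial.eval (fun i => x i) P
  map_add' P Q := by
    ext x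
    by_cases hx : x ∈ cell s <;> simp [hx]
  map_smul' c P := by
    ext x
    by_cases hx : x ∈ cell s <;> simp [hx, MvPolynomial.smul_eval]

/-- The restrictions of a finite element function to the cells. -/
def restrictCells (T : Triangulation Ω) (p : ℕ) : submoduleW T p →ₗ[ℝ]
    (s : T.cells) →
      (MvPolynomial.restrictTotalDegree (Fin d) ℝ p).map (cellPolynomial (s : Finset (E d))) where
  toFun f s := ⟨(cell (s : Finset (E d))).indicator f, by
    obtain ⟨P, hP, h⟩ := f.2.1.1 s s.2
    exact ⟨P, (MvPolynomial.mem_restrictTotalDegree (Fin d) p P).2 hP,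
      (indicator_congr fun x hx => (h x hx)).symm⟩⟩
  map_add' f g := by
    ext s x
    exact congrFun (indicator_add _ (f : E d → ℝ) g) x
  map_smul' c f := by
    ext s x
    exact congrFun (indicator_const_smul _ c (f : E d → ℝ)) x

/-- The restrictions to the cells lie in finite-dimensional spaces and determine the function:
vanishing on all cells means vanishing almost everywhere, hence on `Ω` by continuity. -/
theorem finite_submoduleW (hΩ : interior (closure Ω) = Ω) (T : Triangulation Ω) (p : ℕ) :
    Module.Finite ℝ (submoduleW T p) := by
  refine Module.Finite.of_injective (restrictCells T p)
    ((injective_iff_map_eq_zero (restrictCells T p)).2 fun f hf => ?_)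
  have h0 : ∀ s ∈ T.cells, ∀ x ∈ cell s, (f : E d → ℝ) x = 0 := fun s hs x hx => by
    have h1 := congrFun (congrArg Subtype.val (congrFun hf ⟨s, hs⟩)) x
    have h2 : (cell s).indicator (f : E d → ℝ) x = 0 := h1
    rwa [indicator_of_mem hx] at h2
  have hΩ0 := eqOn_zero_of_ae_eq_zero hΩ f.2.1 (by
    filter_upwards [T.ae_mem_cell hΩ] with x ⟨s, hs, hx⟩ using h0 s hs x hx)
  ext x
  by_cases hx : x ∈ Ω
  · exact hΩ0 hx
  · exact f.2.2 x hx

/-- The `L²` form is definite because the functions are zero outside `Ω`. So it embeds the space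
into its dual, and equality of dimensions gives surjectivity. -/
theorem exists_forall_integral_mul_eq (hΩ : interior (closure Ω) = Ω)
    (L : submoduleW T p →ₗ[ℝ] ℝ) :
    ∃ h ∈ spaceW T p, ∀ g : submoduleW T p, ∫ x in Ω, h x * (g : E d → ℝ) x = L g := by
  have := finite_submoduleW hΩ T p
  have hint : ∀ f g : submoduleW T p,
      Integrable (fun x => (f : E d → ℝ) x * (g : E d → ℝ) x) (volume.restrict Ω) := fun f g =>
    ((piecewiseContinuous_of_mem_spaceW hΩ f.2.1).mul
      (piecewiseContinuous_of_mem_spaceW hΩ g.2.1)).integrable hΩ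
  let B : submoduleW T p →ₗ[ℝ] submoduleW T p →ₗ[ℝ] ℝ := LinearMap.mk₂ ℝ
    (fun f g => ∫ x in Ω, (f : E d → ℝ) x * (g : E d → ℝ) x)
    (fun f f' g => by
      rw [← integral_add (hint f g) (hint f' g)]
      simp [add_mul])
    (fun c f g => by
      rw [smul_eq_mul, ← integral_const_mul]
      simp [mul_assoc])
    (fun f g g' => by
      rw [← integral_add (hint f g) (hint f g')]
      simp [mul_add])
    (fun c f g => by
      rw [smul_eq_mul, ← integral_const_mul]
      simp [mul_left_comm])
  have hinj : Function.Injective B := (injective_iff_map_eq_zero B).2 fun f hf => by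
    have h := eqOn_zero_of_integral_mul_self hΩ f.2.1 (LinearMap.congr_fun hf f)
    ext x
    by_cases hx : x ∈ Ω
    · exact h hx
    · exact f.2.2 x hx
  have hsurj := (LinearMap.injective_iff_surjective_of_finrank_eq_finrank
    (Subspace.dual_finrank_eq (K := ℝ) (V := submoduleW T p)).symm).1 hinj
  obtain ⟨h, hh⟩ := hsurj L
  exact ⟨h, h.2.1, fun g => LinearMap.congr_fun hh g⟩

/-! ### The right-hand side of the equation for the Hessian -/

theorem stiffnessIntegral_congr (hΩ : interior (closure Ω) = Ω) (V : E d → ℝ) {Φ Ψ : E d → ℝ}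
    (h : EqOn Φ Ψ Ω) : stiffnessIntegral Ω V Φ = stiffnessIntegral Ω V Ψ := by
  have hopen : IsOpen Ω := hΩ ▸ isOpen_interior
  ext i j
  simp only [stiffnessIntegral, Matrix.of_apply]
  refine setIntegral_congr_fun hopen.measurableSet fun x hx => ?_
  simp only [gradient, (h.eventuallyEq_of_mem (hopen.mem_nhds hx)).fderiv_eq]

theorem boundaryIntegral_congr (hΩ : interior (closure Ω) = Ω) (V : E d → ℝ) {Φ Ψ : E d → ℝ}
    (hΦ : Φ ∈ spaceW T p) (h : EqOn Φ Ψ Ω) : boundaryIntegral T V Φ = boundaryIntegral T V Ψ := by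
  ext i j
  simp only [boundaryIntegral, Matrix.of_apply]
  refine Finset.sum_congr rfl fun s hs => Finset.sum_congr rfl fun w _ => ?_
  obtain ⟨G, hG, hΦG, -⟩ := exists_contDiff_of_mem_spaceW hΩ hΦ hs
  refine setIntegral_congr_fun (isCompact_closedCell _).measurableSet fun x hx => ?_
  have hx' := closedCell_facet_subset s w hx
  simp only [extendFrom_cell_eq hs hG.continuous hΦG hx', extendFrom_cell_eq hs hG.continuous
    (fun y hy => (h (T.cell_subset hΩ hs hy)).symm.trans (hΦG hy) : EqOn Ψ G (cell s)) hx']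

theorem stiffnessIntegral_add (hΩ : interior (closure Ω) = Ω) {V Φ Ψ : E d → ℝ}
    (hV : V ∈ spaceW T p) (hΦ : Φ ∈ spaceW T p) (hΨ : Ψ ∈ spaceW T p) :
    stiffnessIntegral Ω V (Φ + Ψ) = stiffnessIntegral Ω V Φ + stiffnessIntegral Ω V Ψ := by
  ext i j
  have hg := fun {f} (hf : f ∈ spaceW T p) (k : Fin d) => piecewiseContinuous_gradient_apply hΩ hf k
  simp only [stiffnessIntegral, Matrix.of_apply, Matrix.add_apply]
  rw [← integral_add (((hg hV i).mul (hg hΦ j)).integrable hΩ)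
    (((hg hV i).mul (hg hΨ j)).integrable hΩ)]
  refine integral_congr_ae ?_
  filter_upwards [T.ae_mem_cell hΩ] with x ⟨s, hs, hx⟩
  obtain ⟨F, hF, hΦF, -⟩ := exists_contDiff_of_mem_spaceW hΩ hΦ hs
  obtain ⟨G, hG, hΨG, -⟩ := exists_contDiff_of_mem_spaceW hΩ hΨ hs
  have h1 : DifferentiableAt ℝ Φ x :=
    (hF.differentiable (by simp) x).congr_of_eventuallyEq (eventuallyEq_of_eqOn_cell hΦF hx)
  have h2 : DifferentiableAt ℝ Ψ x :=
    (hG.differentiable (by simp) x).congr_of_eventuallyEq (eventuallyEq_of_eqOn_cell hΨG hx)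
  simp only [gradient_apply, fderiv_add h1 h2, add_apply]
  ring

theorem stiffnessIntegral_smul (V Φ : E d → ℝ) (c : ℝ) :
    stiffnessIntegral Ω V (c • Φ) = c • stiffnessIntegral Ω V Φ := by
  ext i j
  simp only [stiffnessIntegral, Matrix.of_apply, Matrix.smul_apply, smul_eq_mul]
  rw [← integral_const_mul]
  simp only [gradient_apply, fderiv_const_smul_field, smul_apply, smul_eq_mul,
    mul_left_comm, Pi.smul_apply]

theorem integrableOn_boundary (hd : 1 ≤ d) (hΩ : interior (closure Ω) = Ω) {V Φ : E d → ℝ}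
    (hV : V ∈ spaceW T p) (hΦ : Φ ∈ spaceW T p) {s : Finset (E d)} (hs : s ∈ T.cells) {w : E d}
    (hw : w ∈ s) (i j : Fin d) :
    IntegrableOn (fun x => extendFrom (cell s) (gradient V) x i * outwardNormal s w j *
      extendFrom (cell s) Φ x) (closedCell (facet s w))
      (Measure.euclideanHausdorffMeasure (d - 1)) := by
  obtain ⟨F, hF, hVF, -⟩ := exists_contDiff_of_mem_spaceW hΩ hV hs
  obtain ⟨G, hG, hΦG, -⟩ := exists_contDiff_of_mem_spaceW hΩ hΦ hs
  have hc : Continuous fun x => gradient F x i * outwardNormal s w j * G x := by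
    have := continuous_gradient hF
    have := hG.continuous
    fun_prop
  have hmeas := (isCompact_closedCell (facet s w)).measurableSet
  obtain ⟨C, hC⟩ := (isCompact_closedCell (facet s w)).exists_bound_of_continuousOn hc.continuousOn
  have hint : IntegrableOn (fun x => gradient F x i * outwardNormal s w j * G x)
      (closedCell (facet s w)) (Measure.euclideanHausdorffMeasure (d - 1)) :=
    Measure.integrableOn_of_bounded
      (euclideanHausdorffMeasure_closedCell_facet_lt_top T hd hs hw).ne
      hc.aestronglyMeasurable ((ae_restrict_iff' hmeas).2 (Eventually.of_forall hC))
  refine hint.congr_fun (fun x hx => ?_) hmeas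
  have hx' := closedCell_facet_subset s w hx
  simp only [extendFrom_cell_eq hs (continuous_gradient hF) (eqOn_gradient hVF) hx',
    extendFrom_cell_eq hs hG.continuous hΦG hx']

theorem boundaryIntegral_add (hd : 1 ≤ d) (hΩ : interior (closure Ω) = Ω) {V Φ Ψ : E d → ℝ}
    (hV : V ∈ spaceW T p) (hΦ : Φ ∈ spaceW T p) (hΨ : Ψ ∈ spaceW T p) :
    boundaryIntegral T V (Φ + Ψ) = boundaryIntegral T V Φ + boundaryIntegral T V Ψ := by
  ext i j
  simp only [boundaryIntegral, Matrix.of_apply, Matrix.add_apply, ← Finset.sum_add_distrib]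
  refine Finset.sum_congr rfl fun s hs => Finset.sum_congr rfl fun w hw => ?_
  classical
  rw [Finset.mem_filter] at hw
  rw [← integral_add (integrableOn_boundary hd hΩ hV hΦ hs hw.1 i j)
    (integrableOn_boundary hd hΩ hV hΨ hs hw.1 i j)]
  obtain ⟨F, hF, hΦF, -⟩ := exists_contDiff_of_mem_spaceW hΩ hΦ hs
  obtain ⟨G, hG, hΨG, -⟩ := exists_contDiff_of_mem_spaceW hΩ hΨ hs
  refine setIntegral_congr_fun (isCompact_closedCell _).measurableSet fun x hx => ?_
  have hx' := closedCell_facet_subset s w hx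
  have hsum : EqOn (Φ + Ψ) (fun y => F y + G y) (cell s) := fun y hy => by
    simp [hΦF hy, hΨG hy]
  simp only [extendFrom_cell_eq hs hF.continuous hΦF hx', extendFrom_cell_eq hs hG.continuous
    hΨG hx', extendFrom_cell_eq hs (hF.continuous.add hG.continuous) hsum hx', Pi.add_apply]
  ring

theorem boundaryIntegral_smul (hΩ : interior (closure Ω) = Ω) (V : E d → ℝ) {Φ : E d → ℝ}
    (hΦ : Φ ∈ spaceW T p) (c : ℝ) :
    boundaryIntegral T V (c • Φ) = c • boundaryIntegral T V Φ := by
  ext i j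
  simp only [boundaryIntegral, Matrix.of_apply, Matrix.smul_apply, smul_eq_mul, Finset.mul_sum]
  refine Finset.sum_congr rfl fun s hs => Finset.sum_congr rfl fun w hw => ?_
  rw [← integral_const_mul]
  obtain ⟨F, hF, hΦF, -⟩ := exists_contDiff_of_mem_spaceW hΩ hΦ hs
  refine setIntegral_congr_fun (isCompact_closedCell _).measurableSet fun x hx => ?_
  have hx' := closedCell_facet_subset s w hx
  have hsmul : EqOn (c • Φ) (fun y => c * F y) (cell s) := fun y hy => by simp [hΦF hy]
  simp only [extendFrom_cell_eq hs hF.continuous hΦF hx',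
    extendFrom_cell_eq hs (continuous_const.mul hF.continuous) hsmul hx', Pi.mul_apply]
  ring

/-! ### Existence, uniqueness and symmetry of the finite element Hessian -/

theorem exists_isFEHessian (hd : 1 ≤ d) (hΩ : interior (closure Ω) = Ω) {V : E d → ℝ}
    (hV : V ∈ spaceW T p) : ∃ H, IsFEHessian T p V H := by
  let L : Fin d → Fin d → submoduleW T p →ₗ[ℝ] ℝ := fun i j =>
    { toFun := fun Φ => (-stiffnessIntegral Ω V Φ + boundaryIntegral T V Φ) i j
      map_add' := fun Φ Ψ => by
        rw [Submodule.coe_add, stiffnessIntegral_add hΩ hV Φ.2.1 Ψ.2.1,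
          boundaryIntegral_add hd hΩ hV Φ.2.1 Ψ.2.1]
        simp only [Matrix.add_apply, Matrix.neg_apply]
        ring
      map_smul' := fun c Φ => by
        rw [Submodule.coe_smul, stiffnessIntegral_smul, boundaryIntegral_smul hΩ V Φ.2.1]
        simp only [Matrix.add_apply, Matrix.neg_apply, Matrix.smul_apply, smul_eq_mul,
          RingHom.id_apply]
        ring }
  choose h hW hL using fun i j => exists_forall_integral_mul_eq hΩ (L i j)
  refine ⟨fun x => Matrix.of fun i j => h i j x, hW, fun Φ hΦ => ?_⟩
  -- A general `Φ` is replaced by its normalised representative, which changes none of the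
  -- integrals.
  have heq : EqOn Φ (Ω.indicator Φ) Ω := fun x hx => (indicator_of_mem hx _).symm
  let Φ₀ : submoduleW T p :=
    ⟨Ω.indicator Φ, mem_spaceW_congr hΩ hΦ heq.symm, fun x hx => indicator_of_notMem hx _⟩
  rw [stiffnessIntegral_congr hΩ V heq, boundaryIntegral_congr hΩ V hΦ heq]
  ext i j
  refine Eq.trans ?_ (hL i j Φ₀)
  refine setIntegral_congr_fun (hΩ ▸ isOpen_interior : IsOpen Ω).measurableSet fun x hx => ?_
  simp only [Matrix.of_apply, Φ₀, indicator_of_mem hx]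

theorem IsFEHessian.eqOn (hΩ : interior (closure Ω) = Ω) {V : E d → ℝ}
    {H H' : E d → Matrix (Fin d) (Fin d) ℝ} (hH : IsFEHessian T p V H)
    (hH' : IsFEHessian T p V H') : EqOn H H' Ω := fun x hx => by
  ext i j
  -- The difference of the two entries is itself admissible as `Φ`, which gives `∫ D² = 0`.
  have hD : (fun x => H x i j) + (-1 : ℝ) • (fun x => H' x i j) ∈ spaceW T p :=
    add_mem_spaceW (hH.1 i j) (smul_mem_spaceW (-1) (hH'.1 i j))
  set D := (fun x => H x i j) + (-1 : ℝ) • (fun x => H' x i j) with hDdef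
  have hpc := fun {f} (hf : f ∈ spaceW T p) => piecewiseContinuous_of_mem_spaceW hΩ hf
  have h1 := congrFun (congrFun ((hH.2 D hD).trans (hH'.2 D hD).symm) i) j
  simp only [matrixIntegral, Matrix.of_apply] at h1
  rw [← sub_eq_zero, ← integral_sub (((hpc (hH.1 i j)).mul (hpc hD)).integrable hΩ)
    (((hpc (hH'.1 i j)).mul (hpc hD)).integrable hΩ)] at h1
  have h2 := eqOn_zero_of_integral_mul_self hΩ hD (by
    rw [← h1]
    congr 1
    ext y
    simp only [hDdef, Pi.add_apply, Pi.smul_apply, smul_eq_mul]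
    ring) hx
  simp only [hDdef, Pi.add_apply, Pi.smul_apply, smul_eq_mul, Pi.zero_apply] at h2
  linarith

theorem IsFEHessian.matrixIntegral_transpose (hd : 1 ≤ d) (hΩ : interior (closure Ω) = Ω)
    {V : E d → ℝ} (hV : V ∈ spaceV T p) {H : E d → Matrix (Fin d) (Fin d) ℝ}
    (hH : IsFEHessian T p V H) {Φ : E d → ℝ} (hΦ : Φ ∈ spaceW T p) :
    matrixIntegral Ω H Φ = matrixIntegral Ω (fun x => (H x).transpose) Φ := by
  have h1 : matrixIntegral Ω (fun x => (H x).transpose) Φ = (matrixIntegral Ω H Φ).transpose := rfl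
  have h2 : (stiffnessIntegral Ω V Φ).transpose = stiffnessIntegral Ω V Φ := by
    ext i j
    exact integral_gradient_mul_gradient_comm hΩ hV hΦ j i
  rw [h1, hH.2 Φ hΦ, Matrix.transpose_add, Matrix.transpose_neg, h2,
    boundaryIntegral_transpose hd hΩ hV]

end

end FEHessian

end

theorem proposition2p4 (d : ℕ) (hd : 1 ≤ d) (p : ℕ) (Ω : Set (FEHessian.E d))
    (hΩ : interior (closure Ω) = Ω) (T : FEHessian.Triangulation Ω)
    (V : FEHessian.E d → ℝ) (hV : V ∈ FEHessian.spaceV T p) :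
    (∃ H, FEHessian.IsFEHessian T p V H) ∧
    (∀ H H', FEHessian.IsFEHessian T p V H → FEHessian.IsFEHessian T p V H' →
      Set.EqOn H H' Ω) ∧
    (∀ H, FEHessian.IsFEHessian T p V H → ∀ Φ ∈ FEHessian.spaceW T p,
      FEHessian.matrixIntegral Ω H Φ =
        FEHessian.matrixIntegral Ω (fun x => (H x).transpose) Φ) :=
  ⟨FEHessian.exists_isFEHessian hd hΩ hV.1, fun _ _ hH hH' => hH.eqOn hΩ hH',
    fun _ hH _ hΦ => hH.matrixIntegral_transpose hd hΩ hV hΦ⟩
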